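/- Let $V$ be a finite-dimensional vector space over a field $F$ (finite or infinite); a $d$-space is a $d$-dimensional subspace of $V$, $\langle\cdot\rangle$ denotes linear span, and a family of subspaces is called linearly independent if its sum is direct. Let $k,t,n$ be integers with $n\ge 3$ and $2\le t\le k-1$. A set $\mathcal S$ of $k$-spaces is a $(k;k-t,k-t+1)$-SPID if $\dim(\pi\cap\rho)\in\{k-t,k-t+1\}$ for all distinct $\pi,\rho\in\mathcal S$ and each of the two values occurs for some pair of distinct members. $\mathcal S$ is a $(k-t)$-junta if all its members contain a common $(k-t)$-space. A set $\mathcal S=\{\pi_1,\dots,\pi_n\}$ of subspaces belongs to one of the following classes if, for a suitable labelling of its members, the following holds. * **Class I.** There are an integer $m$ with $2<m\le\min\{t+1,n-1\}$ and linearly independent subspaces $V',X,N_1,\dots,N_m,M_{m+1},\dots,M_{n-1}$ with $\dim V'=k-t$, $\dim X=t-m+1$, $\dim N_i=t$, $\dim M_j=t-1$; $1$-spaces $a_i\subseteq N_i$ ($1\le i\le m$); $1$-spaces $b_j\subseteq\langle a_1,\dots,a_m\rangle$ ($m+1\le j\le n-1$) such that $b_j=b_{j'}$ for some $j\ne j'$,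 or $b_j=a_i$ for some $i,j$; and a $(k-t-1)$-space $W\subseteq V'$, such that $\pi_i=\langle V',N_i\rangle$ for $i\le m$, $\pi_j=\langle V',M_j,b_j\rangle$ for $m+1\le j\le n-1$, and $\pi_n=\langle W,a_1,\dots,a_m,X\rangle$. * **Class II.** There are a $(k-t+1)$-space $W$, $t$-spaces $X_1,X_2$ with $\dim\langle X_1,X_2\rangle=2t-1$, and $(t-1)$-spaces $M_3,\dots,M_n$ such that $W,\langle X_1,X_2\rangle,M_3,\dots,M_n$ are linearly independent, and two distinct $(k-t)$-spaces $W_1,W_2\subseteq W$, such that $\pi_1=\langle W_1,X_1\rangle$, $\pi_2=\langle W_2,X_2\rangle$ and $\pi_j=\langle W,M_j\rangle$ for $3\le j\le n$. * **Class III.** There are an integer $s\ge 2$ and linearly independent subspaces $V',\langle X_1,X_2\rangle,M_3,\dots,M_n$ with $\dim V'=k-t+2$, $\dim X_1=t$, $\dim X_2=t-1$, $\dim(X_1\cap X_2)=1$, $\dim M_j=t-1$; distinct $(k-t+1)$-spaces $W_1,\dots,W_s\subseteq V'$ through a common $(k-t)$-space $W$; a $(k-t+1)$-space $W_0\subseteq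 V'$ not containing $W$; and a partition of $\{3,\dots,n\}$ into $s$ nonempty blocks $J_1,\dots,J_s$, such that $\pi_1=\langle W,X_1\rangle$, $\pi_2=\langle W_0,X_2\rangle$ and $\pi_j=\langle W_h,M_j\rangle$ for $j\in J_h$. * **Class IV.** There are an integer $s\ge 2$ and linearly independent subspaces $V',M_1,\dots,M_n$ with $\dim V'=k-t+2$ and $\dim M_j=t-1$; $(k-t+1)$-spaces $V_0,W_0,W_1,\dots,W_s\subseteq V'$ that do not all contain one common $(k-t)$-space, with $W_1,\dots,W_s$ distinct ($V_0$ and $W_0$ may be among them); and a partition of $\{3,\dots,n\}$ into $s$ nonempty blocks $J_1,\dots,J_s$, such that $\pi_1=\langle V_0,M_1\rangle$, $\pi_2=\langle W_0,M_2\rangle$ and $\pi_j=\langle W_h,M_j\rangle$ for $j\in J_h$. **Theorem.** If $\mathcal S$ is a $(k;k-t,k-t+1)$-SPID with $|\mathcal S|=n$ and $\dim\langle\mathcal S\rangle=k+(n-1)(t-1)+1$, then $\mathcal S$ is a $(k-t)$-junta or belongs to one of the Classes I, II, III, IV. Conversely, every set $\mathcal S$ in one of these classes consists of exactly $n$ distinct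 $k$-spaces, any two of which meet in dimension $k-t$ or $k-t+1$, spans a space of dimension $k+(n-1)(t-1)+1$, and is not a $(k-t)$-junta. -/

import Mathlib

open Module

namespace SubspaceCode

variable {F V : Type*} [Field F] [AddCommGroup V] [Module F V]

/-- `S` is a `(k; ℓ₁, …, ℓᵥ)`-SPID with `L = {ℓ₁, …, ℓᵥ}`: a set of `k`-dimensional subspaces such
that any two distinct members meet in a dimension belonging to `L`, and every value in `L` is the
dimension of the intersection of some two distinct members. -/
structure IsSPID (k : ℕ) (L : Set ℕ) (S : Set (Submodule F V)) : Prop where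
  finrank_eq : ∀ π ∈ S, finrank F π = k
  inter_mem : ∀ π ∈ S, ∀ ρ ∈ S, π ≠ ρ → finrank F ↥(π ⊓ ρ) ∈ L
  attained : ∀ ℓ ∈ L, ∃ π ∈ S, ∃ ρ ∈ S, π ≠ ρ ∧ finrank F ↥(π ⊓ ρ) = ℓ

/-- All members of `S` pass through a common `ℓ`-dimensional subspace. -/
def IsJunta (ℓ : ℕ) (S : Set (Submodule F V)) : Prop :=
  ∃ U : Submodule F V, finrank F U = ℓ ∧ ∀ π ∈ S, U ≤ π

/-- Class I. The members are `π₁, …, π_m` (spanned by `V'` and `Nᵢ`), `π_{m+1}, …, π_{n-1}` (spanned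
by `V'`, `Mⱼ` and `bⱼ`; there are `p = n - 1 - m` of them), and `π_n`. "Linearly independent
subspaces" is independence of the family in the lattice of subspaces, i.e. their sum is direct. -/
def IsClassI (k t n : ℕ) (S : Set (Submodule F V)) : Prop :=
  ∃ (m p : ℕ) (V' X W : Submodule F V) (N a : Fin m → Submodule F V)
    (M b : Fin p → Submodule F V),
    2 < m ∧ m ≤ t + 1 ∧ m + p + 1 = n ∧
    iSupIndep (Sum.elim ![V', X] (Sum.elim N M)) ∧
    finrank F V' = k - t ∧ finrank F X = t + 1 - m ∧
    (∀ i, finrank F (N i) = t) ∧ (∀ j, finrank F (M j) = t - 1) ∧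
    (∀ i, finrank F (a i) = 1 ∧ a i ≤ N i) ∧
    (∀ j, finrank F (b j) = 1 ∧ b j ≤ ⨆ i, a i) ∧
    ((∃ j j', j ≠ j' ∧ b j = b j') ∨ (∃ j i, b j = a i)) ∧
    finrank F W = k - t - 1 ∧ W ≤ V' ∧
    S = Set.range (fun i => V' ⊔ N i) ∪ Set.range (fun j => V' ⊔ M j ⊔ b j) ∪
      {W ⊔ (⨆ i, a i) ⊔ X}

/-- Class II. The members are `π₁ = ⟨W₁, X₁⟩`, `π₂ = ⟨W₂, X₂⟩`, and `π₃, …, π_n` (spanned by `W` and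
`Mⱼ`; there are `p = n - 2` of them). -/
def IsClassII (k t n : ℕ) (S : Set (Submodule F V)) : Prop :=
  ∃ (p : ℕ) (W W₁ W₂ X₁ X₂ : Submodule F V) (M : Fin p → Submodule F V),
    p + 2 = n ∧
    iSupIndep (Sum.elim ![W, X₁ ⊔ X₂] M) ∧
    finrank F W = k - t + 1 ∧
    finrank F X₁ = t ∧ finrank F X₂ = t ∧ finrank F ↥(X₁ ⊔ X₂) = 2 * t - 1 ∧
    (∀ j, finrank F (M j) = t - 1) ∧
    finrank F W₁ = k - t ∧ W₁ ≤ W ∧ finrank F W₂ = k - t ∧ W₂ ≤ W ∧ W₁ ≠ W₂ ∧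
    S = {W₁ ⊔ X₁, W₂ ⊔ X₂} ∪ Set.range (fun j => W ⊔ M j)

/-- Class III. The members are `π₁ = ⟨W, X₁⟩`, `π₂ = ⟨W₀, X₂⟩`, and `π₃, …, π_n` (there are
`p = n - 2` of them), which are split into `s` nonempty blocks, the members of the `h`-th block being
spanned by `W_h` and `Mⱼ`. The surjection `c` maps an index to its block. (Hence `s ≤ n - 2`.) -/
def IsClassIII (k t n : ℕ) (S : Set (Submodule F V)) : Prop :=
  ∃ (p s : ℕ) (V' X₁ X₂ W W₀ : Submodule F V) (Wh : Fin s → Submodule F V)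
    (M : Fin p → Submodule F V) (c : Fin p → Fin s),
    p + 2 = n ∧ 2 ≤ s ∧ Function.Surjective c ∧
    iSupIndep (Sum.elim ![V', X₁ ⊔ X₂] M) ∧
    finrank F V' = k - t + 2 ∧
    finrank F X₁ = t ∧ finrank F X₂ = t - 1 ∧ finrank F ↥(X₁ ⊓ X₂) = 1 ∧
    (∀ j, finrank F (M j) = t - 1) ∧
    finrank F W = k - t ∧
    finrank F W₀ = k - t + 1 ∧ W₀ ≤ V' ∧ ¬ W ≤ W₀ ∧
    Function.Injective Wh ∧ (∀ h, finrank F (Wh h) = k - t + 1 ∧ Wh h ≤ V' ∧ W ≤ Wh h) ∧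
    S = {W ⊔ X₁, W₀ ⊔ X₂} ∪ Set.range (fun j => Wh (c j) ⊔ M j)

/-- Class IV. The members are `π₁ = ⟨V₀, M₁⟩`, `π₂ = ⟨W₀, M₂⟩`, and `π₃, …, π_n` (there are
`p = n - 2` of them), which are split into `s` nonempty blocks, the members of the `h`-th block being
spanned by `W_h` and `Mⱼ`. Only `W₁, …, W_s` have to be distinct: `V₀` and `W₀` may be among them. -/
def IsClassIV (k t n : ℕ) (S : Set (Submodule F V)) : Prop :=
  ∃ (p s : ℕ) (V' M₁ M₂ V₀ W₀ : Submodule F V) (Wh : Fin s → Submodule F V)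
    (M : Fin p → Submodule F V) (c : Fin p → Fin s),
    p + 2 = n ∧ 2 ≤ s ∧ Function.Surjective c ∧
    iSupIndep (Sum.elim ![V', M₁, M₂] M) ∧
    finrank F V' = k - t + 2 ∧
    finrank F M₁ = t - 1 ∧ finrank F M₂ = t - 1 ∧ (∀ j, finrank F (M j) = t - 1) ∧
    finrank F V₀ = k - t + 1 ∧ V₀ ≤ V' ∧
    finrank F W₀ = k - t + 1 ∧ W₀ ≤ V' ∧
    Function.Injective Wh ∧ (∀ h, finrank F (Wh h) = k - t + 1 ∧ Wh h ≤ V') ∧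
    (¬ ∃ U : Submodule F V, finrank F U = k - t ∧ U ≤ V₀ ∧ U ≤ W₀ ∧ ∀ h, U ≤ Wh h) ∧
    S = {V₀ ⊔ M₁, W₀ ⊔ M₂} ∪ Set.range (fun j => Wh (c j) ⊔ M j)

end SubspaceCode

namespace SubspaceCode

variable {F V : Type*} [Field F] [AddCommGroup V] [Module F V]

/-! ### Dimension formulas for sums and direct sums of subspaces. -/

section


section LinearAlgebra

variable [FiniteDimensional F V]

/-! Put d = k - t. If the set is not a junta, some three members have a common intersection of
dimension below d (`NonJunta₃`). Each member added to a subfamily with this defect meets its span in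
more than d dimensions (`IsTight.lt_finrank_inf_sup`), so it contributes at most t - 1 new ones. The
prescribed dimension of the whole span leaves no slack, so all these estimates are equalities: the
triple meets pairwise in dimension d and jointly in dimension d - 1, and any member outside a
subfamily containing the triple meets its span in exactly d + 1 dimensions. This is the rigidity
used throughout (`NonJunta₃.le_of_finrank`): once known parts of a member inside such a span fill d
+ 1 dimensions, every other part inside the span lies in them.

Fix α, β with L = α ∩ β of dimension d + 1. Meeting in dimension d + 1 is transitive, and a member
not through L cuts α in a d-space inside L. If no removal of a single member leaves a junta,
rigidity produces a (d+2)-space V' which every member meets in at least d + 1 dimensions; counting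
then makes the members independent modulo V', which is Class IV. Otherwise all members but some σ
share a d-space H, and they cut a complement Q of H ∩ σ in σ in points. If these points span a plane
(dimension 2), Class IV appears again; if they span more, Class I does.

The classification thus ends in Classes I and IV alone; II and III matter only for the converse.
There the members split along a direct sum of three blocks, so that dimensions of intersections can
be computed blockwise (`isExtremal_range_of_blocks`). -/

theorem finrank_iSup_le_sum {ι : Type*} [Fintype ι] (f : ι → Submodule F V) :
    finrank F ↥(⨆ i, f i) ≤ ∑ i, finrank F (f i) := by
  classical
  rw [Submodule.iSup_eq_range_dfinsupp_lsum]
  refine (LinearMap.finrank_range_le _).trans (le_of_eq ?_)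
  exact Module.finrank_directSum (R := F) (fun i => f i)

theorem finrank_iSup_eq_sum {ι : Type*} [Fintype ι] {f : ι → Submodule F V} (h : iSupIndep f) :
    finrank F ↥(⨆ i, f i) = ∑ i, finrank F (f i) := by
  classical
  rw [Submodule.iSup_eq_range_dfinsupp_lsum]
  rw [LinearMap.finrank_range_of_inj h.dfinsupp_lsum_injective]
  exact Module.finrank_directSum (R := F) (fun i => f i)

/-- The summation map from the external direct sum has the supremum as its range, so without loss of
dimension its kernel vanishes. This turns dimension counts into the independence demanded by the
classes. -/
theorem iSupIndep_of_sum_le_finrank {ι : Type*} [Fintype ι] {f : ι → Submodule F V}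
    (h : ∑ i, finrank F (f i) ≤ finrank F ↥(⨆ i, f i)) : iSupIndep f := by
  classical
  apply iSupIndep_of_dfinsupp_lsum_injective
  have hd : finrank F (Π₀ i, f i) = ∑ i, finrank F (f i) :=
    Module.finrank_directSum (R := F) (fun i => f i)
  rw [Submodule.iSup_eq_range_dfinsupp_lsum] at h
  have : FiniteDimensional F (Π₀ i, f i) :=
    inferInstanceAs (Module.Finite F (DirectSum ι fun i => f i))
  set φ := (DFinsupp.lsum ℕ (M := fun i => ↥(f i))) fun i => (f i).subtype
  have hk := LinearMap.finrank_range_add_finrank_ker φ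
  have h0 : finrank F (LinearMap.ker φ) = 0 := by omega
  exact LinearMap.ker_eq_bot.mp (Submodule.finrank_eq_zero.mp h0)

theorem finrank_sup_of_disjoint {A B : Submodule F V} (h : Disjoint A B) :
    finrank F ↥(A ⊔ B) = finrank F A + finrank F B := by
  have := Submodule.finrank_sup_add_finrank_inf_eq A B
  rw [h.eq_bot, finrank_bot] at this
  omega

theorem finrank_lt_sup {A B : Submodule F V} (h : ¬ B ≤ A) :
    finrank F A < finrank F ↥(A ⊔ B) :=
  Submodule.finrank_lt_finrank_of_lt (left_lt_sup.mpr h)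

theorem finrank_inf_lt {A B : Submodule F V} (h : ¬ A ≤ B) :
    finrank F ↥(A ⊓ B) < finrank F A :=
  Submodule.finrank_lt_finrank_of_lt (inf_lt_left.mpr h)

theorem exists_compl_of_le {A B : Submodule F V} (h : A ≤ B) :
    ∃ C, Disjoint A C ∧ A ⊔ C = B ∧ finrank F A + finrank F C = finrank F B := by
  obtain ⟨C, hd, rfl⟩ := IsModularLattice.exists_disjoint_and_sup_eq h
  exact ⟨C, hd, rfl, (finrank_sup_of_disjoint hd).symm⟩

omit [FiniteDimensional F V] in
theorem exists_le_finrank_eq {A : Submodule F V} {d : ℕ} (h : d ≤ finrank F A) :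
    ∃ B ≤ A, finrank F B = d := by
  obtain ⟨v, hv⟩ := exists_linearIndependent_of_le_finrank h
  refine ⟨Submodule.span F (Set.range (A.subtype ∘ v)), ?_, ?_⟩
  · rw [Submodule.span_le]
    rintro _ ⟨i, rfl⟩
    exact (v i).2
  · rw [finrank_span_eq_card (hv.map' A.subtype A.ker_subtype), Fintype.card_fin]

end LinearAlgebra

/-- A vector of A ⊕ B has unique components, so lying in both sums is a condition on each component
separately. -/
theorem sup_inf_sup_of_disjoint {A B A₁ A₂ B₁ B₂ : Submodule F V} (h : Disjoint A B)
    (hA₁ : A₁ ≤ A) (hA₂ : A₂ ≤ A) (hB₁ : B₁ ≤ B) (hB₂ : B₂ ≤ B) :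
    (A₁ ⊔ B₁) ⊓ (A₂ ⊔ B₂) = (A₁ ⊓ A₂) ⊔ (B₁ ⊓ B₂) := by
  apply le_antisymm
  · rintro x ⟨hx₁, hx₂⟩
    obtain ⟨a, ha, b, hb, rfl⟩ := Submodule.mem_sup.mp hx₁
    obtain ⟨a', ha', b', hb', hab⟩ := Submodule.mem_sup.mp hx₂
    have h0 : a' - a = b - b' := by
      rw [sub_eq_sub_iff_add_eq_add, hab, add_comm]
    have h1 : a' - a = 0 := Submodule.disjoint_def.mp h _
      (A.sub_mem (hA₂ ha') (hA₁ ha)) (h0 ▸ B.sub_mem (hB₁ hb) (hB₂ hb'))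
    have h2 : a' = a := sub_eq_zero.mp h1
    have h3 : b = b' := sub_eq_zero.mp (h0 ▸ h1)
    subst h2 h3
    exact Submodule.mem_sup.mpr ⟨a', ⟨ha, ha'⟩, b, ⟨hb, hb'⟩, rfl⟩
  · exact le_inf (sup_le_sup inf_le_left inf_le_left) (sup_le_sup inf_le_right inf_le_right)

/-- The sum of the three subspaces is direct. -/
def Indep₃ (A B C : Submodule F V) : Prop := Disjoint A B ∧ Disjoint (A ⊔ B) C

namespace Indep₃

variable {A B C A₁ A₂ B₁ B₂ C₁ C₂ : Submodule F V}

theorem mono (h : Indep₃ A B C) (hA₁ : A₁ ≤ A) (hB₁ : B₁ ≤ B) (hC₁ : C₁ ≤ C) :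
    Indep₃ A₁ B₁ C₁ :=
  ⟨h.1.mono hA₁ hB₁, h.2.mono (sup_le_sup hA₁ hB₁) hC₁⟩

theorem finrank_sup [FiniteDimensional F V] (h : Indep₃ A B C) :
    finrank F ↥(A ⊔ B ⊔ C) = finrank F A + finrank F B + finrank F C := by
  rw [finrank_sup_of_disjoint h.2, finrank_sup_of_disjoint h.1]

theorem inf_sup (h : Indep₃ A B C) (hA₁ : A₁ ≤ A) (hA₂ : A₂ ≤ A) (hB₁ : B₁ ≤ B) (hB₂ : B₂ ≤ B)
    (hC₁ : C₁ ≤ C) (hC₂ : C₂ ≤ C) :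
    (A₁ ⊔ B₁ ⊔ C₁) ⊓ (A₂ ⊔ B₂ ⊔ C₂) = (A₁ ⊓ A₂) ⊔ (B₁ ⊓ B₂) ⊔ (C₁ ⊓ C₂) := by
  rw [sup_inf_sup_of_disjoint h.2 (sup_le_sup hA₁ hB₁) (sup_le_sup hA₂ hB₂) hC₁ hC₂,
    sup_inf_sup_of_disjoint h.1 hA₁ hA₂ hB₁ hB₂]

theorem finrank_sup_of_le [FiniteDimensional F V] (h : Indep₃ A B C) (hA₁ : A₁ ≤ A)
    (hB₁ : B₁ ≤ B) (hC₁ : C₁ ≤ C) :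
    finrank F ↥(A₁ ⊔ B₁ ⊔ C₁) = finrank F A₁ + finrank F B₁ + finrank F C₁ :=
  (h.mono hA₁ hB₁ hC₁).finrank_sup

theorem finrank_inf [FiniteDimensional F V] (h : Indep₃ A B C) (hA₁ : A₁ ≤ A) (hA₂ : A₂ ≤ A)
    (hB₁ : B₁ ≤ B) (hB₂ : B₂ ≤ B) (hC₁ : C₁ ≤ C) (hC₂ : C₂ ≤ C) :
    finrank F ↥((A₁ ⊔ B₁ ⊔ C₁) ⊓ (A₂ ⊔ B₂ ⊔ C₂)) =
      finrank F ↥(A₁ ⊓ A₂) + finrank F ↥(B₁ ⊓ B₂) + finrank F ↥(C₁ ⊓ C₂) := by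
  rw [h.inf_sup hA₁ hA₂ hB₁ hB₂ hC₁ hC₂]
  exact h.finrank_sup_of_le (inf_le_left.trans hA₁) (inf_le_left.trans hB₁)
    (inf_le_left.trans hC₁)

theorem inf_left (h : Indep₃ A B C) (hA₁ : A₁ ≤ A) (hB₁ : B₁ ≤ B) (hC₁ : C₁ ≤ C) :
    (A₁ ⊔ B₁ ⊔ C₁) ⊓ A = A₁ := by
  have := h.inf_sup hA₁ le_rfl hB₁ (bot_le : ⊥ ≤ B) hC₁ (bot_le : ⊥ ≤ C)
  simpa [inf_eq_left.mpr hA₁] using this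

end Indep₃

theorem iSup_sumElim_pair {ι : Type*} (A B : Submodule F V) (M : ι → Submodule F V) :
    ⨆ i, Sum.elim ![A, B] M i = A ⊔ B ⊔ ⨆ j, M j := by
  rw [iSup_sum]
  congr 1
  apply le_antisymm
  · exact iSup_le fun i => by fin_cases i <;> simp
  · exact sup_le (le_iSup ![A, B] 0) (le_iSup ![A, B] 1)

theorem sum_finrank_sumElim_pair {ι : Type*} [Fintype ι] (A B : Submodule F V)
    (M : ι → Submodule F V) :
    ∑ i, finrank F ↥(Sum.elim ![A, B] M i) =
      finrank F A + finrank F B + ∑ j, finrank F (M j) := by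
  rw [Fintype.sum_sum_type]
  congr 1

section LinearAlgebra

variable [FiniteDimensional F V]

theorem indep₃_of_finrank {A B C : Submodule F V}
    (h : finrank F A + finrank F B + finrank F C ≤ finrank F ↥(A ⊔ B ⊔ C)) : Indep₃ A B C := by
  have h1 := Submodule.finrank_sup_add_finrank_inf_eq A B
  have h2 := Submodule.finrank_sup_add_finrank_inf_eq (A ⊔ B) C
  constructor
  · exact disjoint_iff.mpr (Submodule.finrank_eq_zero.mp (by omega))
  · exact disjoint_iff.mpr (Submodule.finrank_eq_zero.mp (by omega))

theorem indep₃_of_iSupIndep {ι : Type*} [Fintype ι] {A B : Submodule F V} {M : ι → Submodule F V}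
    (h : iSupIndep (Sum.elim ![A, B] M)) : Indep₃ A B (⨆ j, M j) := by
  apply indep₃_of_finrank
  have h1 := finrank_iSup_eq_sum h
  rw [iSup_sumElim_pair, sum_finrank_sumElim_pair] at h1
  have h2 := finrank_iSup_le_sum M
  omega

theorem finrank_iSup_const {ι : Type*} [Fintype ι] {f : ι → Submodule F V} (h : iSupIndep f)
    {c : ℕ} (hc : ∀ i, finrank F (f i) = c) : finrank F ↥(⨆ i, f i) = Fintype.card ι * c := by
  rw [finrank_iSup_eq_sum h]
  simp [hc]

end LinearAlgebra

end

/-! ### The converse: sets in the four classes have the asserted properties. -/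

section


/-- The properties shared by all members of the four classes, with `d = k - t`. -/
def IsExtremal (d t n : ℕ) (S : Set (Submodule F V)) : Prop :=
  S.ncard = n ∧ (∀ π ∈ S, finrank F π = d + t) ∧
    (∀ π ∈ S, ∀ ρ ∈ S, π ≠ ρ → finrank F ↥(π ⊓ ρ) ∈ ({d, d + 1} : Set ℕ)) ∧
    finrank F ↥(sSup S) = d + t + (n - 1) * (t - 1) + 1 ∧ ¬ IsJunta d S

/-- The dimension of a subspace, as a plain function. -/
noncomputable def dim (A : Submodule F V) : ℕ := finrank F A

@[simp]
theorem dim_bot : dim (⊥ : Submodule F V) = 0 := finrank_bot F V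

variable [FiniteDimensional F V]

/-- A family of subspaces that split along a direct sum of three subspaces. -/
theorem isExtremal_range_of_blocks {ι : Type*} [Fintype ι] {d t : ℕ} (ht : 2 ≤ t)
    {A B C : Submodule F V} (hind : Indep₃ A B C) {a b c : ι → Submodule F V}
    (hA : ⨆ i, a i = A) (hB : ⨆ i, b i = B) (hC : ⨆ i, c i = C)
    (hk : ∀ i, dim (a i) + dim (b i) + dim (c i) = d + t)
    (hpair : ∀ i j, i ≠ j →
      dim (a i ⊓ a j) + dim (b i ⊓ b j) + dim (c i ⊓ c j) = d ∨
      dim (a i ⊓ a j) + dim (b i ⊓ b j) + dim (c i ⊓ c j) = d + 1)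
    (htot : finrank F A + finrank F B + finrank F C =
      d + t + (Fintype.card ι - 1) * (t - 1) + 1)
    {i₀ j₀ : ι} (hb₀ : b i₀ ⊓ b j₀ = ⊥) (hc₀ : c i₀ ⊓ c j₀ = ⊥)
    (hU : ¬ ∃ U : Submodule F V, finrank F U = d ∧ ∀ i, U ≤ a i) :
    IsExtremal d t (Fintype.card ι) (Set.range fun i => a i ⊔ b i ⊔ c i) := by
  have ha' : ∀ i, a i ≤ A := fun i => hA ▸ le_iSup a i
  have hb' : ∀ i, b i ≤ B := fun i => hB ▸ le_iSup b i
  have hc' : ∀ i, c i ≤ C := fun i => hC ▸ le_iSup c i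
  have hrank : ∀ i, finrank F ↥(a i ⊔ b i ⊔ c i) = d + t := fun i => by
    rw [hind.finrank_sup_of_le (ha' i) (hb' i) (hc' i)]
    exact hk i
  have hinf : ∀ i j, i ≠ j → finrank F ↥((a i ⊔ b i ⊔ c i) ⊓ (a j ⊔ b j ⊔ c j)) = d ∨
      finrank F ↥((a i ⊔ b i ⊔ c i) ⊓ (a j ⊔ b j ⊔ c j)) = d + 1 := fun i j hij => by
    rw [hind.finrank_inf (ha' i) (ha' j) (hb' i) (hb' j) (hc' i) (hc' j)]
    exact hpair i j hij
  have hinj : Function.Injective fun i => a i ⊔ b i ⊔ c i := by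
    intro i j hij
    by_contra hne
    have h1 := hinf i j hne
    have h2 := hrank j
    simp only at hij
    rw [hij, inf_idem] at h1
    omega
  refine ⟨?_, ?_, ?_, ?_, ?_⟩
  · rw [← Set.image_univ, Set.ncard_image_of_injective _ hinj, Set.ncard_univ,
      Nat.card_eq_fintype_card]
  · rintro _ ⟨i, rfl⟩
    exact hrank i
  · rintro _ ⟨i, rfl⟩ _ ⟨j, rfl⟩ hne
    exact hinf i j fun h => hne (h ▸ rfl)
  · rw [sSup_range, iSup_sup_eq, iSup_sup_eq, hA, hB, hC, hind.finrank_sup, htot]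
  · rintro ⟨U, hUd, hUle⟩
    -- The members `i₀` and `j₀` share nothing in the blocks B and C, so a common subspace is
    -- confined to A, where each member leaves exactly `a i`.
    have hUA : U ≤ A := by
      have := le_inf (hUle _ ⟨i₀, rfl⟩) (hUle _ ⟨j₀, rfl⟩)
      simp only at this
      rw [hind.inf_sup (ha' i₀) (ha' j₀) (hb' i₀) (hb' j₀) (hc' i₀) (hc' j₀), hb₀, hc₀] at this
      refine this.trans ?_
      simpa using inf_le_left.trans (ha' i₀)
    refine hU ⟨U, hUd, fun i => ?_⟩
    have := le_inf (hUle _ ⟨i, rfl⟩) hUA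
    simp only at this
    rwa [hind.inf_left (ha' i) (hb' i) (hc' i)] at this

/-- Two subspaces `A₁ ⊔ B₁`, `A₂ ⊔ B₂`, and further subspaces `W j ⊔ M j`. -/
theorem isExtremal_of_two_blocks {p d t : ℕ} (ht : 2 ≤ t) {A B A₁ A₂ B₁ B₂ : Submodule F V}
    {W M : Fin p → Submodule F V} (hp : 0 < p) (hind : iSupIndep (Sum.elim ![A, B] M))
    (hM : ∀ j, finrank F (M j) = t - 1) (hW : ∀ j, finrank F (W j) = d + 1)
    (hA : A₁ ⊔ A₂ ⊔ ⨆ j, W j = A) (hB : B₁ ⊔ B₂ = B)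
    (h₁ : finrank F A₁ + finrank F B₁ = d + t) (h₂ : finrank F A₂ + finrank F B₂ = d + t)
    (h₁₂ : finrank F ↥(A₁ ⊓ A₂) + finrank F ↥(B₁ ⊓ B₂) = d ∨
      finrank F ↥(A₁ ⊓ A₂) + finrank F ↥(B₁ ⊓ B₂) = d + 1)
    (h₁W : ∀ j, finrank F ↥(A₁ ⊓ W j) = d ∨ finrank F ↥(A₁ ⊓ W j) = d + 1)
    (h₂W : ∀ j, finrank F ↥(A₂ ⊓ W j) = d ∨ finrank F ↥(A₂ ⊓ W j) = d + 1)
    (hWW : ∀ i j, finrank F ↥(W i ⊓ W j) = d ∨ finrank F ↥(W i ⊓ W j) = d + 1)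
    (htot : finrank F A + finrank F B = d + 2 * t)
    (hU : ¬ ∃ U : Submodule F V, finrank F U = d ∧ U ≤ A₁ ∧ U ≤ A₂ ∧ ∀ j, U ≤ W j) :
    IsExtremal d t (p + 2) ({A₁ ⊔ B₁, A₂ ⊔ B₂} ∪ Set.range fun j => W j ⊔ M j) := by
  have hMind : iSupIndep M := hind.comp Sum.inr_injective
  have hMM : ∀ i j, i ≠ j → M i ⊓ M j = ⊥ := fun i j hij => (hMind.pairwiseDisjoint hij).eq_bot
  change dim A₁ + dim B₁ = d + t at h₁
  change dim A₂ + dim B₂ = d + t at h₂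
  change dim (A₁ ⊓ A₂) + dim (B₁ ⊓ B₂) = d ∨ dim (A₁ ⊓ A₂) + dim (B₁ ⊓ B₂) = d + 1 at h₁₂
  change ∀ j, dim (A₁ ⊓ W j) = d ∨ dim (A₁ ⊓ W j) = d + 1 at h₁W
  change ∀ j, dim (A₂ ⊓ W j) = d ∨ dim (A₂ ⊓ W j) = d + 1 at h₂W
  change ∀ i j, dim (W i ⊓ W j) = d ∨ dim (W i ⊓ W j) = d + 1 at hWW
  have hWM : ∀ j, dim (W j) + dim (⊥ : Submodule F V) + dim (M j) = d + t := fun j => by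
    have h₃ : dim (W j) = d + 1 := hW j
    have h₄ : dim (M j) = t - 1 := hM j
    rw [h₃, h₄, dim_bot]
    omega
  have hk : ∀ i : Fin 2 ⊕ Fin p, dim (Sum.elim ![A₁, A₂] W i) +
      dim (Sum.elim ![B₁, B₂] (fun _ => ⊥) i) + dim (Sum.elim (fun _ => ⊥) M i) = d + t := by
    rintro (i | j)
    · revert i
      rw [Fin.forall_fin_two]
      exact ⟨by simpa using h₁, by simpa using h₂⟩
    · exact hWM j
  have hpair : ∀ i j : Fin 2 ⊕ Fin p, i ≠ j →
      dim (Sum.elim ![A₁, A₂] W i ⊓ Sum.elim ![A₁, A₂] W j) +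
        dim (Sum.elim ![B₁, B₂] (fun _ => ⊥) i ⊓ Sum.elim ![B₁, B₂] (fun _ => ⊥) j) +
        dim (Sum.elim (fun _ => ⊥) M i ⊓ Sum.elim (fun _ => ⊥) M j) = d ∨
      dim (Sum.elim ![A₁, A₂] W i ⊓ Sum.elim ![A₁, A₂] W j) +
        dim (Sum.elim ![B₁, B₂] (fun _ => ⊥) i ⊓ Sum.elim ![B₁, B₂] (fun _ => ⊥) j) +
        dim (Sum.elim (fun _ => ⊥) M i ⊓ Sum.elim (fun _ => ⊥) M j) = d + 1 := by
    rintro (i | i) (j | j) hij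
    · revert i j
      simp only [Fin.forall_fin_two]
      refine ⟨⟨fun h => absurd rfl h, fun _ => ?_⟩, fun _ => ?_, fun h => absurd rfl h⟩
      · simpa using h₁₂
      · simpa [inf_comm] using h₁₂
    · revert i
      simp only [Fin.forall_fin_two]
      exact ⟨fun _ => by simpa using h₁W j, fun _ => by simpa using h₂W j⟩
    · revert j
      simp only [Fin.forall_fin_two]
      exact ⟨fun _ => by simpa [inf_comm] using h₁W i, fun _ => by simpa [inf_comm] using h₂W i⟩
    · have hij' : i ≠ j := fun h => hij (h ▸ rfl)
      simpa [hMM i j hij'] using hWW i j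
  have key := isExtremal_range_of_blocks (ι := Fin 2 ⊕ Fin p) (d := d) ht
    (indep₃_of_iSupIndep hind) (a := Sum.elim ![A₁, A₂] W) (b := Sum.elim ![B₁, B₂] fun _ => ⊥)
    (c := Sum.elim (fun _ => ⊥) M) (by rw [iSup_sumElim_pair, hA])
    (by rw [iSup_sumElim_pair, hB]; simp) (by rw [iSup_sum]; simp)
    hk hpair
    (by
      rw [htot, finrank_iSup_const hMind hM, Fintype.card_sum, Fintype.card_fin, Fintype.card_fin]
      obtain ⟨t, rfl⟩ := Nat.exists_eq_add_of_le' ht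
      rw [show 2 + p - 1 = p + 1 by omega, show t + 2 - 1 = t + 1 by omega]
      ring)
    -- The first special member has no C-part and the `W j ⊔ M j` have no B-part, so this pair can
    -- only meet in A.
    (i₀ := .inl 0) (j₀ := .inr ⟨0, hp⟩) (by simp) (by simp)
    (by
      rintro ⟨U, hUd, h⟩
      exact hU ⟨U, hUd, h (.inl 0), h (.inl 1), fun j => h (.inr j)⟩)
  rw [Fintype.card_sum, Fintype.card_fin, Fintype.card_fin, add_comm] at key
  have hS : {A₁ ⊔ B₁, A₂ ⊔ B₂} ∪ Set.range (fun j => W j ⊔ M j) =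
      Set.range fun i => Sum.elim ![A₁, A₂] W i ⊔ Sum.elim ![B₁, B₂] (fun _ => ⊥) i ⊔
        Sum.elim (fun _ => ⊥) M i := by
    ext π
    simp [eq_comm, or_assoc]
  rw [hS]
  exact key

theorem finrank_inf_of_hyperplanes {d : ℕ} {A A₁ A₂ : Submodule F V} (hA : finrank F A = d + 2)
    (h₁ : A₁ ≤ A) (h₂ : A₂ ≤ A) (hd₁ : finrank F A₁ = d + 1) (hd₂ : finrank F A₂ = d + 1) :
    finrank F ↥(A₁ ⊓ A₂) = d ∨ finrank F ↥(A₁ ⊓ A₂) = d + 1 := by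
  have h3 := Submodule.finrank_sup_add_finrank_inf_eq A₁ A₂
  have h4 := Submodule.finrank_mono (sup_le h₁ h₂)
  have h5 := Submodule.finrank_mono (inf_le_left : A₁ ⊓ A₂ ≤ A₁)
  omega

theorem sup_eq_of_hyperplanes {d : ℕ} {A A₁ A₂ : Submodule F V} (hA : finrank F A = d + 1)
    (h₁ : A₁ ≤ A) (h₂ : A₂ ≤ A) (hd₁ : finrank F A₁ = d) (hd₂ : finrank F A₂ = d)
    (hne : A₁ ≠ A₂) : A₁ ⊔ A₂ = A := by
  apply Submodule.eq_of_le_of_finrank_le (sup_le h₁ h₂)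
  have : ¬ A₂ ≤ A₁ := fun h => hne (Submodule.eq_of_le_of_finrank_eq h (hd₂.trans hd₁.symm)).symm
  have := finrank_lt_sup this
  omega

theorem IsClassII.isExtremal {d t n : ℕ} {S : Set (Submodule F V)} (hn : 3 ≤ n) (ht : 2 ≤ t)
    (h : IsClassII (d + t) t n S) : IsExtremal d t n S := by
  obtain ⟨p, W, W₁, W₂, X₁, X₂, M, rfl, hind, hW, hX₁, hX₂, hX, hM, hW₁, hW₁W, hW₂, hW₂W, hne,
    rfl⟩ := h
  rw [Nat.add_sub_cancel] at hW hW₁ hW₂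
  have hsup := sup_eq_of_hyperplanes hW hW₁W hW₂W hW₁ hW₂ hne
  have h1 := Submodule.finrank_sup_add_finrank_inf_eq W₁ W₂
  have h2 := Submodule.finrank_sup_add_finrank_inf_eq X₁ X₂
  rw [hsup] at h1
  have hp : 0 < p := by omega
  refine isExtremal_of_two_blocks ht hp hind hM (fun _ => hW) ?_ rfl (by omega) (by omega)
    (by omega) (fun j => ?_) (fun j => ?_) (fun i j => ?_) (by omega) ?_
  · rw [hsup, sup_eq_left]
    exact iSup_le fun _ => le_rfl
  · rw [inf_eq_left.mpr hW₁W]; omega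
  · rw [inf_eq_left.mpr hW₂W]; omega
  · rw [inf_idem]; omega
  · rintro ⟨U, hU, hU₁, hU₂, -⟩
    have := Submodule.finrank_mono (le_inf hU₁ hU₂)
    omega

theorem IsClassIII.isExtremal {d t n : ℕ} {S : Set (Submodule F V)} (ht : 2 ≤ t)
    (h : IsClassIII (d + t) t n S) : IsExtremal d t n S := by
  obtain ⟨p, s, V', X₁, X₂, W, W₀, Wh, M, c, rfl, hs, hc, hind, hV', hX₁, hX₂, hX, hM, hW, hW₀,
    hW₀V, hWW₀, hinj, hWh, rfl⟩ := h
  rw [Nat.add_sub_cancel] at hV' hW hW₀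
  simp only [Nat.add_sub_cancel] at hWh
  let h₀ : Fin s := ⟨0, by omega⟩
  let h₁ : Fin s := ⟨1, by omega⟩
  obtain ⟨j₀, hj₀⟩ := hc h₀
  obtain ⟨j₁, hj₁⟩ := hc h₁
  have hne : Wh h₀ ≠ Wh h₁ := hinj.ne (by simp [h₀, h₁])
  have hsup := sup_eq_of_hyperplanes hV' (hWh h₀).2.1 (hWh h₁).2.1 (hWh h₀).1 (hWh h₁).1 hne
  have hWV : W ≤ V' := (hWh h₀).2.2.trans (hWh h₀).2.1
  have h2 := Submodule.finrank_sup_add_finrank_inf_eq X₁ X₂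
  have h3 := Submodule.finrank_sup_add_finrank_inf_eq W W₀
  have h4 := Submodule.finrank_mono (sup_le hWV hW₀V)
  have h5 := finrank_inf_lt hWW₀
  refine isExtremal_of_two_blocks ht j₀.pos hind hM (fun j => (hWh (c j)).1) ?_ rfl (by omega)
    (by omega) (by omega) (fun j => ?_) (fun j => ?_) (fun i j => ?_) (by omega) ?_
  · apply le_antisymm
    · exact sup_le (sup_le hWV hW₀V) (iSup_le fun j => (hWh _).2.1)
    · rw [← hsup]
      refine le_sup_of_le_right (sup_le ?_ ?_)
      · exact hj₀ ▸ le_iSup (fun j => Wh (c j)) j₀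
      · exact hj₁ ▸ le_iSup (fun j => Wh (c j)) j₁
  · rw [inf_eq_left.mpr (hWh _).2.2]; omega
  · exact finrank_inf_of_hyperplanes hV' hW₀V (hWh _).2.1 hW₀ (hWh _).1
  · exact finrank_inf_of_hyperplanes hV' (hWh _).2.1 (hWh _).2.1 (hWh _).1 (hWh _).1
  · rintro ⟨U, hU, hU₁, hU₂, -⟩
    have := Submodule.finrank_mono (le_inf hU₁ hU₂)
    omega

/-- Merging M₁ and M₂ into one block brings Class IV into the shape of `isExtremal_of_two_blocks`.
-/
theorem iSupIndep_sup_of_cons {ι : Type*} [Fintype ι] {A B C : Submodule F V}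
    {M : ι → Submodule F V} (h : iSupIndep (Sum.elim ![A, B, C] M)) :
    iSupIndep (Sum.elim ![A, B ⊔ C] M) ∧ Disjoint B C := by
  have hBC : Disjoint B C := by
    have := h.pairwiseDisjoint (i := .inl 1) (j := .inl 2) (by simp)
    simpa [Function.onFun] using this
  refine ⟨iSupIndep_of_sum_le_finrank ?_, hBC⟩
  have h1 := finrank_iSup_eq_sum h
  have h2 : ⨆ i, ![A, B, C] i = A ⊔ (B ⊔ C) := by
    apply le_antisymm
    · refine iSup_le fun i => ?_
      fin_cases i
      · exact le_sup_left
      · exact le_sup_left.trans le_sup_right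
      · exact le_sup_right.trans le_sup_right
    · exact sup_le (le_iSup ![A, B, C] 0) (sup_le (le_iSup ![A, B, C] 1) (le_iSup ![A, B, C] 2))
  have h3 : ∑ i, finrank F ↥(![A, B, C] i) = finrank F A + finrank F B + finrank F C :=
    Fin.sum_univ_three _
  have h4 : ⨆ i, Sum.elim ![A, B, C] M i = A ⊔ (B ⊔ C) ⊔ ⨆ j, M j := by
    rw [iSup_sum, ← h2]
    rfl
  have h5 : ∑ i, finrank F ↥(Sum.elim ![A, B, C] M i) =
      finrank F A + finrank F B + finrank F C + ∑ j, finrank F (M j) := by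
    rw [Fintype.sum_sum_type, ← h3]
    rfl
  rw [h4, h5] at h1
  rw [iSup_sumElim_pair, sum_finrank_sumElim_pair, h1, finrank_sup_of_disjoint hBC]
  omega

theorem IsClassIV.isExtremal {d t n : ℕ} {S : Set (Submodule F V)} (ht : 2 ≤ t)
    (h : IsClassIV (d + t) t n S) : IsExtremal d t n S := by
  obtain ⟨p, s, V', M₁, M₂, V₀, W₀, Wh, M, c, rfl, hs, hc, hind, hV', hM₁, hM₂, hM, hV₀, hV₀V, hW₀,
    hW₀V, hinj, hWh, hU, rfl⟩ := h
  rw [Nat.add_sub_cancel] at hV' hV₀ hW₀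
  simp only [Nat.add_sub_cancel] at hWh hU
  let h₀ : Fin s := ⟨0, by omega⟩
  let h₁ : Fin s := ⟨1, by omega⟩
  obtain ⟨j₀, hj₀⟩ := hc h₀
  obtain ⟨j₁, hj₁⟩ := hc h₁
  have hne : Wh h₀ ≠ Wh h₁ := hinj.ne (by simp [h₀, h₁])
  have hsup := sup_eq_of_hyperplanes hV' (hWh h₀).2 (hWh h₁).2 (hWh h₀).1 (hWh h₁).1 hne
  obtain ⟨hind', hdis⟩ := iSupIndep_sup_of_cons hind
  have h2 := finrank_sup_of_disjoint hdis
  refine isExtremal_of_two_blocks ht j₀.pos hind' hM (fun j => (hWh (c j)).1) ?_ rfl (by omega)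
    (by omega) ?_ (fun j => ?_) (fun j => ?_) (fun i j => ?_) (by omega) ?_
  · apply le_antisymm
    · exact sup_le (sup_le hV₀V hW₀V) (iSup_le fun j => (hWh _).2)
    · rw [← hsup]
      refine le_sup_of_le_right (sup_le ?_ ?_)
      · exact hj₀ ▸ le_iSup (fun j => Wh (c j)) j₀
      · exact hj₁ ▸ le_iSup (fun j => Wh (c j)) j₁
  · rw [hdis.eq_bot, finrank_bot]
    exact finrank_inf_of_hyperplanes hV' hV₀V hW₀V hV₀ hW₀
  · exact finrank_inf_of_hyperplanes hV' hV₀V (hWh _).2 hV₀ (hWh _).1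
  · exact finrank_inf_of_hyperplanes hV' hW₀V (hWh _).2 hW₀ (hWh _).1
  · exact finrank_inf_of_hyperplanes hV' (hWh _).2 (hWh _).2 (hWh _).1 (hWh _).1
  · rintro ⟨U, hUd, hU₁, hU₂, hU₃⟩
    refine hU ⟨U, hUd, hU₁, hU₂, fun h => ?_⟩
    obtain ⟨j, rfl⟩ := hc h
    exact hU₃ j

omit [FiniteDimensional F V] in
-- Split along `N i` and the sum of the other `N j`: only `a i` has a component in the former.
theorem inf_iSup_eq_of_iSupIndep {ι : Type*} {N a : ι → Submodule F V} (h : iSupIndep N)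
    (ha : ∀ i, a i ≤ N i) (i : ι) : N i ⊓ ⨆ j, a j = a i := by
  have h1 := sup_inf_sup_of_disjoint (h i) le_rfl (ha i) bot_le
    (iSup₂_mono fun j _ => ha j : (⨆ (j) (_ : j ≠ i), a j) ≤ ⨆ (j) (_ : j ≠ i), N j)
  rw [← iSup_split_single a i, sup_bot_eq, bot_inf_eq, sup_bot_eq, inf_eq_right.mpr (ha i)] at h1
  exact h1

theorem IsClassI.isExtremal {d t n : ℕ} {S : Set (Submodule F V)} (ht : 2 ≤ t) (hd : 1 ≤ d)
    (h : IsClassI (d + t) t n S) : IsExtremal d t n S := by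
  obtain ⟨m, p, V', X, W, N, a, M, b, hm, hmt, rfl, hind, hV', hX, hN, hM, ha, hb, -, hW, hWV,
    rfl⟩ := h
  rw [Nat.add_sub_cancel] at hV' hW
  have hNM : iSupIndep (Sum.elim N M) := hind.comp Sum.inr_injective
  have hNind : iSupIndep N := hNM.comp Sum.inl_injective
  have hMind : iSupIndep M := hNM.comp Sum.inr_injective
  have hXN : Disjoint X (⨆ i, N i) := by
    refine (indep₃_of_iSupIndep hind).2.mono le_sup_right ?_
    rw [iSup_sum]
    exact le_sup_left
  have hNr := finrank_iSup_const hNind hN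
  have hMr := finrank_iSup_const hMind hM
  have hXNr := finrank_sup_of_disjoint hXN
  rw [Fintype.card_fin] at hNr hMr
  -- X and the Nᵢ form one block because the points bⱼ and the last member run across several Nᵢ.
  have hind₃ : Indep₃ V' (X ⊔ ⨆ i, N i) (⨆ j, M j) := by
    apply indep₃_of_finrank
    have h1 := (indep₃_of_iSupIndep hind).finrank_sup
    rw [finrank_iSup_eq_sum hNM, Fintype.sum_sum_type] at h1
    change _ = _ + _ + (∑ i, finrank F (N i) + ∑ j, finrank F (M j)) at h1
    rw [iSup_sum] at h1
    change finrank F ↥(V' ⊔ X ⊔ ((⨆ i, N i) ⊔ ⨆ j, M j)) = _ at h1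
    rw [← finrank_iSup_eq_sum hNind, ← finrank_iSup_eq_sum hMind] at h1
    rw [← sup_assoc, sup_assoc V'] at h1
    omega
  have haN : ⨆ i, a i ≤ ⨆ i, N i := iSup_mono fun i => (ha i).2
  have har : finrank F ↥(⨆ i, a i) = m := by
    rw [finrank_iSup_const (hNind.mono fun i => (ha i).2) fun i => (ha i).1, Fintype.card_fin,
      mul_one]
  have haX : finrank F ↥((⨆ i, a i) ⊔ X) = t + 1 := by
    rw [finrank_sup_of_disjoint (hXN.symm.mono_left haN), har, hX]
    omega
  have hNa : ∀ i, N i ⊓ ((⨆ i, a i) ⊔ X) = a i := fun i => by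
    have := sup_inf_sup_of_disjoint hXN.symm (le_iSup N i) haN (bot_le : ⊥ ≤ X) le_rfl
    rwa [sup_bot_eq, bot_inf_eq, sup_bot_eq, inf_iSup_eq_of_iSupIndep hNind fun i => (ha i).2]
      at this
  have hba : ∀ j, b j ⊓ ((⨆ i, a i) ⊔ X) = b j :=
    fun j => inf_eq_left.mpr ((hb j).2.trans le_sup_left)
  have hNN : ∀ i j, i ≠ j → N i ⊓ N j = ⊥ := fun i j hij => (hNind.pairwiseDisjoint hij).eq_bot
  have hMM : ∀ i j, i ≠ j → M i ⊓ M j = ⊥ := fun i j hij => (hMind.pairwiseDisjoint hij).eq_bot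
  have hVW : V' ⊓ W = W := inf_eq_right.mpr hWV
  have hWV' : W ⊓ V' = W := inf_eq_left.mpr hWV
  have hNa' : ∀ i, ((⨆ i, a i) ⊔ X) ⊓ N i = a i := fun i => inf_comm (N i) _ ▸ hNa i
  have hba' : ∀ j, ((⨆ i, a i) ⊔ X) ⊓ b j = b j := fun j => inf_comm (b j) _ ▸ hba j
  change dim V' = d at hV'
  change dim W = d - 1 at hW
  change dim ((⨆ i, a i) ⊔ X) = t + 1 at haX
  have hbr : ∀ j, dim (b j) = 1 := fun j => (hb j).1
  have har' : ∀ i, dim (a i) = 1 := fun i => (ha i).1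
  have hbY : ∀ j (Y : Submodule F V), dim (b j ⊓ Y) ≤ 1 := fun j Y =>
    (hbr j) ▸ Submodule.finrank_mono (inf_le_left : b j ⊓ Y ≤ b j)
  have hk : ∀ i : (Fin m ⊕ Fin p) ⊕ Unit,
      dim (Sum.elim (fun _ => V') (fun _ => W) i) +
      dim (Sum.elim (Sum.elim N b) (fun _ => (⨆ i, a i) ⊔ X) i) +
      dim (Sum.elim (Sum.elim (fun _ => ⊥) M) (fun _ => ⊥) i) = d + t := by
    rintro ((i | j) | _)
    · have : dim (N i) = t := hN i
      simp [hV', this]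
    · have : dim (M j) = t - 1 := hM j
      simp only [Sum.elim_inl, Sum.elim_inr, hV', this, hbr]
      omega
    · simp only [Sum.elim_inr, hW, haX, dim_bot]
      omega
  have hpair : ∀ i j : (Fin m ⊕ Fin p) ⊕ Unit, i ≠ j → ∀ s,
      s = dim (Sum.elim (fun _ => V') (fun _ => W) i ⊓ Sum.elim (fun _ => V') (fun _ => W) j) +
        dim (Sum.elim (Sum.elim N b) (fun _ => (⨆ i, a i) ⊔ X) i ⊓
          Sum.elim (Sum.elim N b) (fun _ => (⨆ i, a i) ⊔ X) j) +
        dim (Sum.elim (Sum.elim (fun _ => ⊥) M) (fun _ => ⊥) i ⊓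
          Sum.elim (Sum.elim (fun _ => ⊥) M) (fun _ => ⊥) j) →
      s = d ∨ s = d + 1 := by
    rintro ((i | i) | i) ((j | j) | j) hij s hs <;>
      simp only [Sum.elim_inl, Sum.elim_inr, inf_idem, hV', hVW, hWV', hW, hNa, hNa', hba, hba',
        har', hbr, bot_inf_eq, inf_bot_eq, dim_bot] at hs
    · have hij' : i ≠ j := fun h => hij (h ▸ rfl)
      rw [hNN i j hij', dim_bot] at hs
      omega
    · have := hbY j (N i)
      rw [inf_comm] at this
      omega
    · omega
    · have := hbY i (N j)
      omega
    · have hij' : i ≠ j := fun h => hij (h ▸ rfl)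
      have := hbY i (b j)
      rw [hMM i j hij', dim_bot] at hs
      omega
    · omega
    · omega
    · omega
    · exact absurd rfl hij
  have key := isExtremal_range_of_blocks ht hind₃
    (a := Sum.elim (fun _ : Fin m ⊕ Fin p => V') (fun _ : Unit => W))
    (b := Sum.elim (Sum.elim N b) (fun _ => (⨆ i, a i) ⊔ X))
    (c := Sum.elim (Sum.elim (fun _ => ⊥) M) (fun _ => ⊥))
    (by
      have : Nonempty (Fin m ⊕ Fin p) := ⟨.inl ⟨0, by omega⟩⟩
      simpa [iSup_sum] using hWV)
    (by
      have h1 : ⨆ j, b j ≤ ⨆ i, N i := iSup_le fun j => (hb j).2.trans haN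
      rw [iSup_sum, iSup_sum]
      change ((⨆ i, N i) ⊔ ⨆ j, b j) ⊔ (⨆ _ : Unit, (⨆ i, a i) ⊔ X) = _
      rw [sup_eq_left.mpr h1, iSup_const, ← sup_assoc, sup_eq_left.mpr haN, sup_comm])
    (by simp [iSup_sum])
    hk (fun i j hij => hpair i j hij _ rfl)
    (by
      change dim V' + _ + _ = _
      rw [hV', hXNr, hNr, hMr, hX]
      obtain ⟨t, rfl⟩ := Nat.exists_eq_add_of_le' (show 1 ≤ t by omega)
      simp only [Fintype.card_sum, Fintype.card_fin, Fintype.card_unit, Nat.add_sub_cancel]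
      have h3 : t + 1 + 1 - m + m = t + 1 + 1 := by omega
      linarith [add_mul m p t, mul_add m t 1])
    (i₀ := .inl (.inl ⟨0, by omega⟩)) (j₀ := .inl (.inl ⟨1, by omega⟩))
    (hNN _ _ (by simp)) (by simp)
    (by
      -- The last member leaves only W in the block V', and dim W = d - 1 < d as d ≥ 1.
      rintro ⟨U, hUd, hU⟩
      have h1 : dim U ≤ dim W := Submodule.finrank_mono (hU (.inr ()))
      have h2 : dim U = d := hUd
      omega)
  have hcard : Fintype.card ((Fin m ⊕ Fin p) ⊕ Unit) = m + p + 1 := by simp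
  rw [hcard] at key
  have hS : Set.range (fun i => V' ⊔ N i) ∪ Set.range (fun j => V' ⊔ M j ⊔ b j) ∪
      {W ⊔ (⨆ i, a i) ⊔ X} = Set.range fun i : (Fin m ⊕ Fin p) ⊕ Unit =>
        Sum.elim (fun _ => V') (fun _ => W) i ⊔
        Sum.elim (Sum.elim N b) (fun _ => (⨆ i, a i) ⊔ X) i ⊔
        Sum.elim (Sum.elim (fun _ => ⊥) M) (fun _ => ⊥) i := by
    ext π
    simp [eq_comm, sup_assoc, sup_comm (b _)]
    tauto
  rw [hS]
  exact key

end

/-! ### Triples without a common d-space, and the rigidity they impose. -/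

section


/-- A set of `(d + t)`-spaces that meets the hypotheses of the classification without being a
`d`-junta. -/
structure IsTight (d t : ℕ) (S : Finset (Submodule F V)) : Prop where
  two_le : 2 ≤ t
  rank : ∀ π ∈ S, finrank F π = d + t
  inter : ∀ π ∈ S, ∀ ρ ∈ S, π ≠ ρ → finrank F ↥(π ⊓ ρ) = d ∨ finrank F ↥(π ⊓ ρ) = d + 1
  attained : ∃ π ∈ S, ∃ ρ ∈ S, π ≠ ρ ∧ finrank F ↥(π ⊓ ρ) = d
  span : finrank F ↥(S.sup id) = d + t + (S.card - 1) * (t - 1) + 1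
  not_junta : ¬ IsJunta d (S : Set (Submodule F V))

/-- Three distinct members of `S` without a common `d`-space. -/
structure NonJunta₃ (d : ℕ) (S : Finset (Submodule F V)) (x y z : Submodule F V) : Prop where
  mem₁ : x ∈ S
  mem₂ : y ∈ S
  mem₃ : z ∈ S
  ne₁₂ : x ≠ y
  ne₁₃ : x ≠ z
  ne₂₃ : y ≠ z
  lt : finrank F ↥(x ⊓ y ⊓ z) < d

theorem NonJunta₃.swap {d : ℕ} {S : Finset (Submodule F V)} {x y z : Submodule F V}
    (h : NonJunta₃ d S x y z) : NonJunta₃ d S y x z :=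
  ⟨h.mem₂, h.mem₁, h.mem₃, h.ne₁₂.symm, h.ne₂₃, h.ne₁₃, by rw [inf_comm y]; exact h.lt⟩

theorem NonJunta₃.rotate {d : ℕ} {S : Finset (Submodule F V)} {x y z : Submodule F V}
    (h : NonJunta₃ d S x y z) : NonJunta₃ d S y z x :=
  ⟨h.mem₂, h.mem₃, h.mem₁, h.ne₂₃, h.ne₁₂.symm, h.ne₁₃.symm, by
    rw [inf_comm, ← inf_assoc]; exact h.lt⟩

variable [FiniteDimensional F V] {d t : ℕ} {S : Finset (Submodule F V)}

theorem eq_of_le_of_le_finrank {A B : Submodule F V} (h : A ≤ B) {c : ℕ} (hA : c ≤ finrank F A)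
    (hB : finrank F B ≤ c) : A = B :=
  Submodule.eq_of_le_of_finrank_le h (hB.trans hA)

theorem finset_inf_pair {α : Type*} [Lattice α] [BoundedOrder α] [DecidableEq α] (x y : α) :
    Finset.inf {x, y} id = x ⊓ y := by
  simp

theorem finset_sup_pair {α : Type*} [Lattice α] [BoundedOrder α] [DecidableEq α] (x y : α) :
    Finset.sup {x, y} id = x ⊔ y := by
  simp

theorem finset_inf_triple {α : Type*} [Lattice α] [BoundedOrder α] [DecidableEq α] (x y z : α) :
    Finset.inf {x, y, z} id = x ⊓ y ⊓ z := by
  simp [inf_assoc]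

theorem finset_sup_triple {α : Type*} [Lattice α] [BoundedOrder α] [DecidableEq α] (x y z : α) :
    Finset.sup {x, y, z} id = x ⊔ y ⊔ z := by
  simp [sup_assoc]

namespace IsTight

omit [FiniteDimensional F V] in
theorem le_finrank_inf (h : IsTight d t S) {x y : Submodule F V} (hx : x ∈ S) (hy : y ∈ S)
    (hxy : x ≠ y) : d ≤ finrank F ↥(x ⊓ y) := by
  have := h.inter x hx y hy hxy
  omega

/-- If π met the span of A in at most d dimensions, then each π ∩ ρ with ρ ∈ A, of dimension at
least d, would fill that intersection. All of them would coincide and lie in every member of A,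
against `hlt`. -/
theorem lt_finrank_inf_sup (h : IsTight d t S) {A : Finset (Submodule F V)} (hA : A ⊆ S)
    (hne : A.Nonempty) {π : Submodule F V} (hπ : π ∈ S) (hπA : π ∉ A)
    (hlt : finrank F ↥(π ⊓ A.inf id) < d) : d < finrank F ↥(π ⊓ A.sup id) := by
  by_contra! hle
  have heq : ∀ ρ ∈ A, π ⊓ ρ = π ⊓ A.sup id := fun ρ hρ =>
    eq_of_le_of_le_finrank (inf_le_inf_left _ (Finset.le_sup (f := id) hρ))
      (h.le_finrank_inf hπ (hA hρ) fun e => hπA (e ▸ hρ)) hle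
  obtain ⟨ρ, hρ⟩ := hne
  have h1 : π ⊓ A.sup id ≤ π ⊓ A.inf id :=
    le_inf inf_le_left (Finset.le_inf fun τ hτ => heq τ hτ ▸ inf_le_right)
  have h2 := Submodule.finrank_mono h1
  have h3 := h.le_finrank_inf hπ (hA hρ) fun e => hπA (e ▸ hρ)
  rw [heq ρ hρ] at h3
  omega

-- Members are added one at a time; each meets the span so far in at least d + 1 of its d + t
-- dimensions.
open Classical in
theorem finrank_sup_union_le (h : IsTight d t S) {A : Finset (Submodule F V)} (hA : A ⊆ S)
    (hne : A.Nonempty) (hlt : finrank F ↥(A.inf id) < d) (B : Finset (Submodule F V))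
    (hB : B ⊆ S) (hAB : Disjoint A B) :
    finrank F ↥((A ∪ B).sup id) ≤ finrank F ↥(A.sup id) + B.card * (t - 1) := by
  induction B using Finset.induction_on with
  | empty => rw [Finset.union_empty]; omega
  | insert π B hπ ih =>
    rw [Finset.disjoint_insert_right] at hAB
    rw [Finset.insert_subset_iff] at hB
    have ih := ih hB.2 hAB.2
    have hlt' : finrank F ↥(π ⊓ (A ∪ B).inf id) < d :=
      (Submodule.finrank_mono
        (inf_le_right.trans (Finset.inf_mono Finset.subset_union_left))).trans_lt hlt
    have h1 := h.lt_finrank_inf_sup (Finset.union_subset hA hB.2)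
      (hne.mono Finset.subset_union_left) hB.1 (by simp [hAB.1, hπ]) hlt'
    have h2 := Submodule.finrank_sup_add_finrank_inf_eq π ((A ∪ B).sup id)
    rw [h.rank π hB.1] at h2
    rw [Finset.union_insert, Finset.sup_insert, Finset.card_insert_of_notMem hπ, add_mul, id]
    omega

/-- The members outside A add at most t - 1 dimensions each, so A must already supply the rest of
the prescribed span. -/
theorem le_finrank_sup (h : IsTight d t S) {A : Finset (Submodule F V)} (hA : A ⊆ S)
    (hne : A.Nonempty) (hlt : finrank F ↥(A.inf id) < d) :
    d + t + (A.card - 1) * (t - 1) + 1 ≤ finrank F ↥(A.sup id) := by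
  classical
  have h1 := h.finrank_sup_union_le hA hne hlt (S \ A) Finset.sdiff_subset Finset.disjoint_sdiff
  have h2 := Finset.card_sdiff_add_card_eq_card hA
  have h3 := hne.card_pos
  rw [Finset.union_sdiff_of_subset hA, h.span,
    show S.card - 1 = (S \ A).card + (A.card - 1) by omega, add_mul] at h1
  omega

/-- The span of x and y has dimension at most d + 2t and z adds at most t - 1. The total is exactly
the lower bound of `le_finrank_sup` for three members, so both estimates are sharp. -/
theorem finrank_triple (h : IsTight d t S) {x y z : Submodule F V} (hN : NonJunta₃ d S x y z) :
    finrank F ↥(x ⊓ y) = d ∧ finrank F ↥(z ⊓ (x ⊔ y)) = d + 1 ∧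
      finrank F ↥(x ⊔ y ⊔ z) = d + t + 2 * (t - 1) + 1 := by
  classical
  have hxy := h.le_finrank_inf hN.mem₁ hN.mem₂ hN.ne₁₂
  have ht := h.two_le
  have h1 := h.le_finrank_sup (A := {x, y, z})
    (by simp [Finset.insert_subset_iff, hN.mem₁, hN.mem₂, hN.mem₃]) (by simp)
    (by rw [finset_inf_triple]; exact hN.lt)
  have h2 := h.lt_finrank_inf_sup (A := {x, y}) (π := z)
    (by simp [Finset.insert_subset_iff, hN.mem₁, hN.mem₂]) (by simp) hN.mem₃
    (by simp [hN.ne₁₃.symm, hN.ne₂₃.symm]) (by rw [finset_inf_pair, inf_comm]; exact hN.lt)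
  rw [Finset.card_eq_three.mpr ⟨x, y, z, hN.ne₁₂, hN.ne₁₃, hN.ne₂₃, rfl⟩] at h1
  rw [finset_sup_triple] at h1
  rw [finset_sup_pair] at h2
  have h3 := Submodule.finrank_sup_add_finrank_inf_eq x y
  have h4 := Submodule.finrank_sup_add_finrank_inf_eq (x ⊔ y) z
  rw [inf_comm (x ⊔ y)] at h4
  rw [h.rank x hN.mem₁, h.rank y hN.mem₂] at h3
  rw [h.rank z hN.mem₃] at h4
  omega

end IsTight

namespace NonJunta₃

variable {x y z : Submodule F V}

theorem finrank_inf₁₂ (hN : NonJunta₃ d S x y z) (h : IsTight d t S) : finrank F ↥(x ⊓ y) = d :=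
  (h.finrank_triple hN).1

theorem finrank_inf₂₃ (hN : NonJunta₃ d S x y z) (h : IsTight d t S) : finrank F ↥(y ⊓ z) = d :=
  hN.rotate.finrank_inf₁₂ h

theorem finrank_inf₁₃ (hN : NonJunta₃ d S x y z) (h : IsTight d t S) : finrank F ↥(x ⊓ z) = d :=
  hN.swap.finrank_inf₂₃ h

/-- A further member meets the span of any set containing the triple in dimension `d + 1`. -/
theorem finrank_inf_sup (hN : NonJunta₃ d S x y z) (h : IsTight d t S)
    {A : Finset (Submodule F V)} (hA : A ⊆ S) (hx : x ∈ A) (hy : y ∈ A) (hz : z ∈ A)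
    {π : Submodule F V} (hπ : π ∈ S) (hπA : π ∉ A) : finrank F ↥(π ⊓ A.sup id) = d + 1 := by
  classical
  have hle : A.inf id ≤ x ⊓ y ⊓ z := le_inf (le_inf (Finset.inf_le (f := id) hx)
    (Finset.inf_le (f := id) hy)) (Finset.inf_le (f := id) hz)
  have hlt : finrank F ↥(A.inf id) < d := (Submodule.finrank_mono hle).trans_lt hN.lt
  have ht := h.two_le
  have hT : ({x, y, z} : Finset (Submodule F V)) ⊆ A := by
    simp [Finset.insert_subset_iff, hx, hy, hz]
  have hTc := Finset.card_eq_three.mpr ⟨x, y, z, hN.ne₁₂, hN.ne₁₃, hN.ne₂₃, rfl⟩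
  have h1 := h.finrank_sup_union_le (hT.trans hA) (by simp) (by rw [finset_inf_triple]; exact hN.lt)
    (A \ {x, y, z}) (Finset.sdiff_subset.trans hA) Finset.disjoint_sdiff
  rw [Finset.union_sdiff_of_subset hT] at h1
  rw [finset_sup_triple] at h1
  rw [(h.finrank_triple hN).2.2] at h1
  have h2 := Finset.card_sdiff_add_card_eq_card hT
  have h3 := h.lt_finrank_inf_sup hA ⟨x, hx⟩ hπ hπA
    ((Submodule.finrank_mono inf_le_right).trans_lt hlt)
  -- The upper bound for the span of A, counted from the exact dimension of the triple, and the
  -- lower bound for A with π added differ by t - 1; so π contributes at least t - 1.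
  have h4 := h.le_finrank_sup (A := insert π A) (Finset.insert_subset hπ hA) (by simp)
    (by
      rw [Finset.inf_insert]
      exact (Submodule.finrank_mono inf_le_right).trans_lt hlt)
  rw [Finset.card_insert_of_notMem hπA, Finset.sup_insert, id, Nat.add_sub_cancel] at h4
  have h5 := Submodule.finrank_sup_add_finrank_inf_eq π (A.sup id)
  rw [h.rank π hπ] at h5
  have h6 : A.card * (t - 1) = (A \ {x, y, z}).card * (t - 1) + 3 * (t - 1) := by
    rw [← add_mul, ← h2, hTc]
  omega

/-- Two subspaces of `π` in the span of a set containing the triple, the first one of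
dimension `d + 1`. -/
theorem le_of_finrank (hN : NonJunta₃ d S x y z) (h : IsTight d t S)
    {A : Finset (Submodule F V)} (hA : A ⊆ S) (hx : x ∈ A) (hy : y ∈ A) (hz : z ∈ A)
    {π : Submodule F V} (hπ : π ∈ S) (hπA : π ∉ A) {E₁ E₂ : Submodule F V} (h₁ : E₁ ≤ π)
    (h₂ : E₂ ≤ π) (hA₁ : E₁ ≤ A.sup id) (hA₂ : E₂ ≤ A.sup id) (hd : d + 1 ≤ finrank F E₁) :
    E₂ ≤ E₁ := by
  have := eq_of_le_of_le_finrank (le_inf h₁ hA₁) hd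
    (hN.finrank_inf_sup h hA hx hy hz hπ hπA).le
  exact this ▸ le_inf h₂ hA₂

/-- The d-spaces x ∩ z and y ∩ z both lie in z ∩ ⟨x, y⟩, of dimension d + 1, so they share at least
d - 1 dimensions. -/
theorem finrank_inf_add_one (hN : NonJunta₃ d S x y z) (h : IsTight d t S) :
    finrank F ↥(x ⊓ y ⊓ z) + 1 = d := by
  have h1 := (h.finrank_triple hN).2.1
  have h2 : (x ⊓ z) ⊔ (y ⊓ z) ≤ z ⊓ (x ⊔ y) := sup_le
    (le_inf inf_le_right (inf_le_left.trans le_sup_left))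
    (le_inf inf_le_right (inf_le_left.trans le_sup_right))
  have h3 := Submodule.finrank_mono h2
  have h4 := Submodule.finrank_sup_add_finrank_inf_eq (x ⊓ z) (y ⊓ z)
  rw [← inf_inf_distrib_right, hN.finrank_inf₁₃ h, hN.finrank_inf₂₃ h] at h4
  have := hN.lt
  omega

theorem not_inf_le (hN : NonJunta₃ d S x y z) (h : IsTight d t S) : ¬ x ⊓ y ≤ z := fun hle => by
  have h1 := hN.lt
  rw [inf_eq_left.mpr hle, hN.finrank_inf₁₂ h] at h1
  omega

/-- No further member contains the pairwise intersections of the triple. -/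
theorem not_forall_inf_le (hN : NonJunta₃ d S x y z) (h : IsTight d t S) {u : Submodule F V}
    (hu : u ∈ S) (hux : u ≠ x) (huy : u ≠ y) (huz : u ≠ z) :
    ¬ (x ⊓ y ≤ u ∧ x ⊓ z ≤ u ∧ y ⊓ z ≤ u) := by
  classical
  rintro ⟨hxy, hxz, hyz⟩
  have h1 : ¬ x ⊓ z ≤ x ⊓ y := fun hle =>
    hN.rotate.rotate.not_inf_le h (inf_comm z x ▸ hle.trans inf_le_right)
  have h2 := finrank_lt_sup h1
  rw [hN.finrank_inf₁₂ h] at h2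
  have hs : x ≤ Finset.sup {x, y, z} id := Finset.le_sup (f := id) (by simp)
  have hs' : y ≤ Finset.sup {x, y, z} id := Finset.le_sup (f := id) (by simp)
  -- Two of the pairwise intersections already span d + 1 dimensions of u inside x; rigidity would
  -- force y ∩ z into x as well.
  have h3 := hN.le_of_finrank h (A := {x, y, z}) (E₂ := y ⊓ z)
    (by simp [Finset.insert_subset_iff, hN.mem₁, hN.mem₂, hN.mem₃]) (by simp) (by simp) (by simp)
    hu (by simp [hux, huy, huz]) (sup_le hxy hxz) hyz
    (sup_le (inf_le_left.trans hs) (inf_le_left.trans hs)) (inf_le_left.trans hs') h2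
  exact hN.rotate.not_inf_le h (h3.trans (sup_le inf_le_left inf_le_left))

end NonJunta₃

theorem inf_le_of_not_nonJunta₃ {x y z : Submodule F V} (hx : x ∈ S)
    (hy : y ∈ S) (hz : z ∈ S) (hxy : x ≠ y) (hxz : x ≠ z) (hyz : y ≠ z)
    (hd : finrank F ↥(x ⊓ y) = d) (hN : ¬ NonJunta₃ d S x y z) : x ⊓ y ≤ z := by
  have h1 : d ≤ finrank F ↥(x ⊓ y ⊓ z) := by
    by_contra! hlt
    exact hN ⟨hx, hy, hz, hxy, hxz, hyz, hlt⟩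
  exact inf_eq_left.mp (eq_of_le_of_le_finrank inf_le_left h1 hd.le)

namespace IsTight

theorem exists_nonJunta₃ (h : IsTight d t S) : ∃ x y z, NonJunta₃ d S x y z := by
  obtain ⟨x, hx, y, hy, hxy, hd⟩ := h.attained
  have : ∃ z ∈ S, ¬ x ⊓ y ≤ z := by
    by_contra! hall
    exact h.not_junta ⟨x ⊓ y, hd, hall⟩
  obtain ⟨z, hz, hle⟩ := this
  refine ⟨x, y, z, hx, hy, hz, hxy, ?_, ?_, ?_⟩
  · rintro rfl
    exact hle inf_le_left
  · rintro rfl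
    exact hle inf_le_right
  · exact (finrank_inf_lt hle).trans_eq hd

/-- Otherwise v, y, u would be a triple without a common d-space, and u ∩ v would have dimension d.
-/
theorem inf_le_of_finrank (h : IsTight d t S) {u v y : Submodule F V} (hu : u ∈ S)
    (hv : v ∈ S) (hy : y ∈ S) (huv : u ≠ v) (huy : u ≠ y) (hvy : v ≠ y)
    (hd : finrank F ↥(u ⊓ v) = d + 1) (hd' : finrank F ↥(v ⊓ y) = d) : v ⊓ y ≤ u :=
  inf_le_of_not_nonJunta₃ hv hy hu hvy huv.symm huy.symm hd' fun hN => by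
    have := hN.finrank_inf₁₃ h
    rw [inf_comm] at this
    omega

/-- Meeting in dimension `d + 1` is transitive. -/
theorem inf_le_of_adj (h : IsTight d t S) {u v w : Submodule F V} (hu : u ∈ S) (hv : v ∈ S)
    (hw : w ∈ S) (huv : u ≠ v) (hvw : v ≠ w) (huvd : finrank F ↥(u ⊓ v) = d + 1)
    (hvwd : finrank F ↥(v ⊓ w) = d + 1) : u ⊓ v ≤ w := by
  classical
  by_contra hle
  -- For a triple avoiding v, rigidity applies to v and the span of the triple with u and w: v ∩ w
  -- fills d + 1 dimensions, hence contains u ∩ v.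
  have hmem : ∀ x y z, NonJunta₃ d S x y z → v = x ∨ v = y ∨ v = z := by
    intro x y z hN
    by_contra! hne
    have hs : u ≤ Finset.sup {x, y, z, u, w} id := Finset.le_sup (f := id) (by simp)
    have hs' : w ≤ Finset.sup {x, y, z, u, w} id := Finset.le_sup (f := id) (by simp)
    have := hN.le_of_finrank h (A := {x, y, z, u, w}) (E₁ := v ⊓ w) (E₂ := u ⊓ v)
      (by simp [Finset.insert_subset_iff, hN.mem₁, hN.mem₂, hN.mem₃, hu, hw]) (by simp) (by simp)
      (by simp) hv (by simp [hne, huv.symm, hvw]) inf_le_left inf_le_right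
      (inf_le_right.trans hs') (inf_le_left.trans hs) hvwd.ge
    exact hle (this.trans inf_le_right)
  -- Replacing v by u either gives a triple avoiding v, or makes u contain all pairwise
  -- intersections of v, y, z; both are excluded.
  have main : ∀ y z, ¬ NonJunta₃ d S v y z := by
    intro y z hN
    have huy : u ≠ y := by
      rintro rfl
      have := hN.finrank_inf₁₂ h
      rw [inf_comm] at this
      omega
    have huz : u ≠ z := by
      rintro rfl
      have := hN.finrank_inf₁₃ h
      rw [inf_comm] at this
      omega
    by_cases hN' : NonJunta₃ d S y z u
    · rcases hmem _ _ _ hN' with e | e | e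
      · exact hN.ne₁₂ e
      · exact hN.ne₁₃ e
      · exact huv e.symm
    · exact hN.not_forall_inf_le h hu huv huy huz
        ⟨h.inf_le_of_finrank hu hv hN.mem₂ huv huy hN.ne₁₂ huvd (hN.finrank_inf₁₂ h),
          h.inf_le_of_finrank hu hv hN.mem₃ huv huz hN.ne₁₃ huvd (hN.finrank_inf₁₃ h),
          inf_le_of_not_nonJunta₃ hN.mem₂ hN.mem₃ hu hN.ne₂₃ huy.symm huz.symm
            (hN.finrank_inf₂₃ h) hN'⟩
  obtain ⟨x, y, z, hN⟩ := h.exists_nonJunta₃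
  rcases hmem _ _ _ hN with rfl | rfl | rfl
  · exact main _ _ hN
  · exact main _ _ hN.rotate
  · exact main _ _ hN.rotate.rotate

end IsTight

end

/-! ### Class IV: members independent modulo a (d+2)-space. -/

section

variable [FiniteDimensional F V] {d t : ℕ} {S : Finset (Submodule F V)}

omit [FiniteDimensional F V] in
theorem iSup_sumElim_triple {ι : Type*} (A B C : Submodule F V) (M : ι → Submodule F V) :
    ⨆ i, Sum.elim ![A, B, C] M i = A ⊔ B ⊔ C ⊔ ⨆ j, M j := by
  rw [iSup_sum]
  congr 1
  apply le_antisymm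
  · refine iSup_le fun i => ?_
    fin_cases i
    · exact le_sup_left.trans le_sup_left
    · exact le_sup_right.trans le_sup_left
    · exact le_sup_right
  · exact sup_le (sup_le (le_iSup ![A, B, C] 0) (le_iSup ![A, B, C] 1)) (le_iSup ![A, B, C] 2)

omit [FiniteDimensional F V] in
theorem sum_finrank_sumElim_triple {ι : Type*} [Fintype ι] (A B C : Submodule F V)
    (M : ι → Submodule F V) :
    ∑ i, finrank F ↥(Sum.elim ![A, B, C] M i) =
      finrank F A + finrank F B + finrank F C + ∑ j, finrank F (M j) := by
  rw [Fintype.sum_sum_type]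
  congr 1
  exact Fin.sum_univ_three _

theorem nonJunta₃_of_inf_ne {α ρ σ : Submodule F V} (hα : α ∈ S) (hρ : ρ ∈ S) (hσ : σ ∈ S)
    (hαρ : α ≠ ρ) (hασ : α ≠ σ) (hρα : finrank F ↥(ρ ⊓ α) = d) (hσα : finrank F ↥(σ ⊓ α) = d)
    (hne : ρ ⊓ α ≠ σ ⊓ α) : NonJunta₃ d S α ρ σ := by
  refine ⟨hα, hρ, hσ, hαρ, hασ, fun e => hne (e ▸ rfl), ?_⟩
  by_contra! hle
  have h1 : α ⊓ ρ ⊓ σ = ρ ⊓ α :=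
    eq_of_le_of_le_finrank (le_inf (inf_le_left.trans inf_le_right)
      (inf_le_left.trans inf_le_left)) hle hρα.le
  have h2 : α ⊓ ρ ⊓ σ = σ ⊓ α :=
    eq_of_le_of_le_finrank (le_inf inf_le_right (inf_le_left.trans inf_le_left)) hle hσα.le
  exact hne (h1.symm.trans h2)

namespace IsTight

/-- If all members meet a `(d + 2)`-space in dimension at least `d + 1`, then they are independent
modulo that space. -/
theorem exists_complements (h : IsTight d t S) {V' : Submodule F V} (hV' : finrank F V' = d + 2)
    (hle : ∀ π ∈ S, d + 1 ≤ finrank F ↥(π ⊓ V')) :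
    ∃ M : Submodule F V → Submodule F V, ∀ π ∈ S, (π ⊓ V') ⊔ M π = π ∧
      finrank F ↥(π ⊓ V') = d + 1 ∧ finrank F (M π) = t - 1 := by
  have hM : ∀ π : Submodule F V, ∃ C, (π ⊓ V') ⊔ C = π ∧
      finrank F ↥(π ⊓ V') + finrank F C = finrank F π := fun π => by
    obtain ⟨C, -, h1, h2⟩ := exists_compl_of_le (inf_le_left : π ⊓ V' ≤ π)
    exact ⟨C, h1, h2⟩
  choose M hM hMd using hM
  have ht := h.two_le
  have hcard : 0 < S.card := by
    obtain ⟨x, hx, -⟩ := h.attained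
    exact Finset.card_pos.mpr ⟨x, hx⟩
  have h1 : S.sup id ≤ V' ⊔ ⨆ i : S, M i := Finset.sup_le fun π hπ => by
    rw [id, ← hM π]
    exact sup_le_sup inf_le_right (le_iSup (fun i : S => M i) ⟨π, hπ⟩)
  have h2 := Submodule.finrank_mono h1
  have h3 := Submodule.finrank_add_le_finrank_add_finrank V' (⨆ i : S, M i)
  have h4 := finrank_iSup_le_sum fun i : S => M i
  rw [Finset.sum_coe_sort S fun π => finrank F (M π)] at h4
  have h5 : ∀ π ∈ S, finrank F (M π) ≤ t - 1 := fun π hπ => by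
    have := hle π hπ
    have := hMd π
    have := h.rank π hπ
    omega
  have h6 : ∑ π ∈ S, (t - 1) = (S.card - 1) * (t - 1) + (t - 1) := by
    rw [Finset.sum_const, smul_eq_mul, ← Nat.succ_mul]
    congr 1
    omega
  have h7 := h.span
  -- V' and the complements span at most d + 2 + n(t - 1) = d + t + (n - 1)(t - 1) + 1 dimensions,
  -- exactly the prescribed number; hence every complement has full dimension t - 1.
  have h8 := (Finset.sum_eq_sum_iff_of_le h5).mp
    (le_antisymm (Finset.sum_le_sum h5) (by omega))
  refine ⟨M, fun π hπ => ⟨hM π, ?_, h8 π hπ⟩⟩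
  have := h8 π hπ
  have := hMd π
  have := h.rank π hπ
  omega

/-- The members u and z serve as π₁ and π₂. This keeps x and y among the others; their traces on V'
differ since x ∩ y has dimension only d, and so there are at least two blocks. -/
theorem isClassIV (h : IsTight d t S) {V' : Submodule F V} (hV' : finrank F V' = d + 2)
    (hle : ∀ π ∈ S, d + 1 ≤ finrank F ↥(π ⊓ V')) {x y z u : Submodule F V}
    (hN : NonJunta₃ d S x y z) (hu : u ∈ S) (hux : u ≠ x) (huy : u ≠ y) (huz : u ≠ z) :
    IsClassIV (d + t) t S.card (S : Set (Submodule F V)) := by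
  classical
  obtain ⟨M, hM⟩ := h.exists_complements hV' hle
  have ht := h.two_le
  have hxy : x ⊓ V' ≠ y ⊓ V' := fun e => by
    have h1 : x ⊓ V' ≤ x ⊓ y := le_inf inf_le_left (e ▸ inf_le_left)
    have h2 := Submodule.finrank_mono h1
    rw [hN.finrank_inf₁₂ h, (hM x hN.mem₁).2.1] at h2
    omega
  set T := (S.erase u).erase z with hT
  have hTS : ∀ {π}, π ∈ T → π ∈ S := fun hπ =>
    Finset.mem_of_mem_erase (Finset.mem_of_mem_erase hπ)
  have hTc : T.card + 2 = S.card := by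
    have h1 := Finset.card_erase_add_one hu
    have h2 := Finset.card_erase_add_one (Finset.mem_erase.mpr ⟨huz.symm, hN.mem₃⟩)
    rw [← hT] at h2
    omega
  have hxT : x ∈ T := by simp [hT, hN.ne₁₃, hux.symm, hN.mem₁]
  have hyT : y ∈ T := by simp [hT, hN.ne₂₃, huy.symm, hN.mem₂]
  have hSm : ∀ π, π ∈ S ↔ (π = u ∨ π = z) ∨ π ∈ T := by
    intro π
    simp only [hT, Finset.mem_erase]
    constructor
    · tauto
    · rintro ((rfl | rfl) | h)
      · exact hu
      · exact hN.mem₃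
      · exact h.2.2
  -- The distinct traces on V' are the W_h; a block consists of the members with the same trace.
  let R := T.image fun π => π ⊓ V'
  have hR : ∀ τ ∈ R, finrank F τ = d + 1 ∧ τ ≤ V' := by
    intro τ hτ
    obtain ⟨π, hπ, rfl⟩ := Finset.mem_image.mp hτ
    exact ⟨(hM π (hTS hπ)).2.1, inf_le_right⟩
  let e := T.equivFin
  let r := R.equivFin
  have hind : iSupIndep (Sum.elim ![V', M u, M z] fun j => M (e.symm j)) := by
    apply iSupIndep_of_sum_le_finrank
    have h1 : S.sup id ≤ ⨆ i, Sum.elim ![V', M u, M z] (fun j => M (e.symm j)) i := by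
      rw [iSup_sumElim_triple]
      refine Finset.sup_le fun π hπ => ?_
      rw [id, ← (hM π hπ).1]
      refine sup_le (inf_le_right.trans (le_sup_left.trans (le_sup_left.trans le_sup_left))) ?_
      rcases (hSm π).mp hπ with (rfl | rfl) | hπT
      · exact le_sup_right.trans (le_sup_left.trans le_sup_left)
      · exact le_sup_right.trans le_sup_left
      · have := le_iSup (fun j => M (e.symm j)) (e ⟨π, hπT⟩)
        rw [Equiv.symm_apply_apply] at this
        exact this.trans le_sup_right
    have h2 := Submodule.finrank_mono h1
    have h3 : ∑ j, finrank F (M (e.symm j)) = T.card * (t - 1) := by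
      rw [Finset.sum_congr rfl fun j _ => (hM _ (hTS (e.symm j).2)).2.2]
      simp
    rw [h.span, show S.card - 1 = T.card + 1 by omega, add_mul] at h2
    rw [sum_finrank_sumElim_triple, hV', (hM u hu).2.2, (hM z hN.mem₃).2.2, h3]
    omega
  unfold IsClassIV
  simp only [Nat.add_sub_cancel]
  refine ⟨T.card, R.card, V', M u, M z, u ⊓ V', z ⊓ V', fun i => r.symm i,
    fun j => M (e.symm j), fun j => r ⟨_, Finset.mem_image_of_mem _ (e.symm j).2⟩, hTc, ?_, ?_,
    hind, hV', (hM u hu).2.2, (hM z hN.mem₃).2.2, fun j => (hM _ (hTS (e.symm j).2)).2.2,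
    (hM u hu).2.1, inf_le_right, (hM z hN.mem₃).2.1, inf_le_right, ?_, fun i => hR _ (r.symm i).2,
    ?_, ?_⟩
  · exact Finset.one_lt_card.mpr ⟨_, Finset.mem_image_of_mem _ hxT, _,
      Finset.mem_image_of_mem _ hyT, hxy⟩
  · intro i
    obtain ⟨π, hπ, hπi⟩ := Finset.mem_image.mp (r.symm i).2
    refine ⟨e ⟨π, hπ⟩, ?_⟩
    apply r.symm.injective
    rw [Equiv.symm_apply_apply]
    apply Subtype.ext
    rw [← hπi]
    simp
  · exact Subtype.val_injective.comp r.symm.injective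
  · rintro ⟨U, hUd, hUu, hUz, hU⟩
    refine h.not_junta ⟨U, hUd, fun π hπ => ?_⟩
    rcases (hSm π).mp hπ with (rfl | rfl) | hπT
    · exact hUu.trans inf_le_left
    · exact hUz.trans inf_le_left
    · have : U ≤ r.symm (r ⟨π ⊓ V', Finset.mem_image_of_mem _ hπT⟩) := hU _
      rw [Equiv.symm_apply_apply] at this
      exact this.trans inf_le_left
  · have hj : ∀ j, (↑(r.symm (r ⟨_, Finset.mem_image_of_mem _ (e.symm j).2⟩)) : Submodule F V) ⊔
        M (e.symm j) = e.symm j := fun j => by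
      rw [Equiv.symm_apply_apply]
      exact (hM _ (hTS (e.symm j).2)).1
    simp only [hj]
    rw [(hM u hu).1, (hM z hN.mem₃).1]
    ext π
    rw [Finset.mem_coe, hSm π]
    simp only [Set.mem_union, Set.mem_insert_iff, Set.mem_singleton_iff, Set.mem_range]
    refine or_congr Iff.rfl ⟨fun hπ => ⟨e ⟨π, hπ⟩, by simp⟩, ?_⟩
    rintro ⟨j, rfl⟩
    exact (e.symm j).2

/-- One of two members that meet in dimension `d + 1` lies outside a given triple. -/
theorem exists_ne (h : IsTight d t S) {α β x y z : Submodule F V} (hα : α ∈ S) (hβ : β ∈ S)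
    (hαβ : α ≠ β) (hd : finrank F ↥(α ⊓ β) = d + 1) (hN : NonJunta₃ d S x y z) :
    ∃ u ∈ S, u ≠ x ∧ u ≠ y ∧ u ≠ z := by
  by_contra! hall
  have hmem : ∀ u ∈ S, u = x ∨ u = y ∨ u = z := fun u hu => by
    have := hall u hu
    tauto
  have h12 := hN.finrank_inf₁₂ h
  have h13 := hN.finrank_inf₁₃ h
  have h23 := hN.finrank_inf₂₃ h
  have h21 := inf_comm x y ▸ h12
  have h31 := inf_comm x z ▸ h13
  have h32 := inf_comm y z ▸ h23
  rcases hmem α hα with rfl | rfl | rfl <;> rcases hmem β hβ with rfl | rfl | rfl <;>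
    first | exact hαβ rfl | omega

section Star

variable {α β ρ σ : Submodule F V}

/-- Meeting α in dimension d + 1 would force ρ through α ∩ β by transitivity; so ρ ∩ α is a d-space,
and it lies in β by `inf_le_of_finrank`. -/
theorem finrank_inf_of_not_inf_le (h : IsTight d t S) (hα : α ∈ S) (hβ : β ∈ S) (hαβ : α ≠ β)
    (hd : finrank F ↥(α ⊓ β) = d + 1) (hρ : ρ ∈ S) (hle : ¬ α ⊓ β ≤ ρ) :
    finrank F ↥(ρ ⊓ α) = d ∧ ρ ⊓ α ≤ α ⊓ β := by
  have hρα : ρ ≠ α := fun e => hle (e ▸ inf_le_left)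
  have hρβ : ρ ≠ β := fun e => hle (e ▸ inf_le_right)
  have h1 : finrank F ↥(ρ ⊓ α) = d := by
    refine (h.inter ρ hρ α hα hρα).resolve_right fun h2 => hle ?_
    rw [inf_comm]
    exact h.inf_le_of_adj hβ hα hρ hαβ.symm hρα.symm (inf_comm α β ▸ hd) (inf_comm ρ α ▸ h2)
  refine ⟨h1, le_inf inf_le_right ?_⟩
  rw [inf_comm]
  exact h.inf_le_of_finrank hβ hα hρ hαβ.symm hρβ.symm hρα.symm (inf_comm α β ▸ hd)
    (inf_comm ρ α ▸ h1)

theorem finrank_star (h : IsTight d t S) (hN : NonJunta₃ d S α ρ σ) :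
    finrank F ↥((ρ ⊓ α) ⊔ (ρ ⊓ σ)) = d + 1 := by
  have h1 := Submodule.finrank_sup_add_finrank_inf_eq (ρ ⊓ α) (ρ ⊓ σ)
  have h2 := hN.finrank_inf_add_one h
  have h3 := hN.finrank_inf₁₂ h
  have h4 := hN.finrank_inf₂₃ h
  rw [inf_comm] at h3
  have h5 : (ρ ⊓ α) ⊓ (ρ ⊓ σ) = α ⊓ ρ ⊓ σ := by
    rw [← inf_inf_distrib_left]
    ac_rfl
  rw [h5] at h1
  omega

/-- A set without a point whose removal leaves a junta belongs to Class IV. -/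
theorem isClassIV_of_not_star (h : IsTight d t S) (hα : α ∈ S) (hβ : β ∈ S) (hαβ : α ≠ β)
    (hd : finrank F ↥(α ⊓ β) = d + 1)
    (hstar : ∀ σ ∈ S, ∀ H : Submodule F V, finrank F H = d → ∃ π ∈ S, π ≠ σ ∧ ¬ H ≤ π) :
    IsClassIV (d + t) t S.card (S : Set (Submodule F V)) := by
  classical
  have hin := fun ρ (hρ : ρ ∈ S) hle => h.finrank_inf_of_not_inf_le hα hβ hαβ hd (ρ := ρ) hρ hle
  have hne : ∀ {ρ}, ¬ α ⊓ β ≤ ρ → α ≠ ρ := fun hle e => hle (e ▸ inf_le_left)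
  have key : ∀ ρ ∈ S, ∀ σ ∈ S, ∀ τ ∈ S, ¬ α ⊓ β ≤ ρ → ¬ α ⊓ β ≤ σ → ρ ⊓ α ≠ σ ⊓ α → ρ ≠ τ →
      ρ ⊓ τ ≤ (α ⊓ β) ⊔ (ρ ⊓ σ) := by
    intro ρ hρ σ hσ τ hτ hρL hσL hρσ hρτ
    -- This π completes α, σ to a triple that avoids ρ, so rigidity applies to ρ: its d + 1
    -- dimensions in the span are ρ ∩ α and ρ ∩ σ together.
    obtain ⟨π, hπ, hπρ, hπσ⟩ := hstar ρ hρ (σ ⊓ α) (hin σ hσ hσL).1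
    have hπL : ¬ α ⊓ β ≤ π := fun hle => hπσ ((hin σ hσ hσL).2.trans hle)
    have hN := nonJunta₃_of_inf_ne hα hσ hπ (hne hσL) (hne hπL) (hin σ hσ hσL).1
      (hin π hπ hπL).1 fun e => hπσ (e ▸ inf_le_left)
    have hNρ := nonJunta₃_of_inf_ne hα hρ hσ (hne hρL) (hne hσL) (hin ρ hρ hρL).1
      (hin σ hσ hσL).1 hρσ
    have hs : ∀ μ ∈ ({α, σ, π, τ} : Finset (Submodule F V)),
        μ ≤ Finset.sup {α, σ, π, τ} id := fun μ hμ => Finset.le_sup (f := id) hμ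
    have h1 := hN.le_of_finrank h (A := {α, σ, π, τ}) (E₁ := (ρ ⊓ α) ⊔ (ρ ⊓ σ)) (E₂ := ρ ⊓ τ)
      (by simp [Finset.insert_subset_iff, hα, hσ, hπ, hτ]) (by simp) (by simp) (by simp)
      hρ (by simp [(hne hρL).symm, hNρ.ne₂₃, hπρ.symm, hρτ])
      (sup_le inf_le_left inf_le_left) inf_le_left
      (sup_le (inf_le_right.trans (hs _ (by simp))) (inf_le_right.trans (hs _ (by simp))))
      (inf_le_right.trans (hs _ (by simp))) (h.finrank_star hNρ).ge
    exact h1.trans (sup_le_sup_right (hin ρ hρ hρL).2 _)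
  have hex : ∀ H : Submodule F V, finrank F H = d → ∃ π ∈ S, ¬ H ≤ π := fun H hH => by
    obtain ⟨π, hπ, -, hle⟩ := hstar α hα H hH
    exact ⟨π, hπ, hle⟩
  obtain ⟨H, hHL, hHd⟩ := exists_le_finrank_eq (hd.ge.trans' (Nat.le_succ d))
  obtain ⟨ρ, hρ, hHρ⟩ := hex H hHd
  have hρL : ¬ α ⊓ β ≤ ρ := fun hle => hHρ (hHL.trans hle)
  obtain ⟨σ, hσ, hρσ⟩ := hex _ (hin ρ hρ hρL).1
  have hσL : ¬ α ⊓ β ≤ σ := fun hle => hρσ ((hin ρ hρ hρL).2.trans hle)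
  have hρσ' : ρ ⊓ α ≠ σ ⊓ α := fun e => hρσ (e ▸ inf_le_left)
  have hN := nonJunta₃_of_inf_ne hα hρ hσ (hne hρL) (hne hσL) (hin ρ hρ hρL).1
    (hin σ hσ hσL).1 hρσ'
  -- Since ρ ∩ α lies in L = α ∩ β, L meets ρ ∩ σ in the triple intersection α ∩ ρ ∩ σ, giving (d +
  -- 1) + d - (d - 1).
  have hV' : finrank F ↥((α ⊓ β) ⊔ (ρ ⊓ σ)) = d + 2 := by
    have h1 := Submodule.finrank_sup_add_finrank_inf_eq (α ⊓ β) (ρ ⊓ σ)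
    have h2 := hN.finrank_inf_add_one h
    have h3 : (α ⊓ β) ⊓ (ρ ⊓ σ) = α ⊓ ρ ⊓ σ := by
      rw [inf_assoc α ρ]
      apply le_antisymm (inf_le_inf_right _ inf_le_left)
      exact le_inf ((le_inf (inf_le_right.trans inf_le_left) inf_le_left).trans
        (hin ρ hρ hρL).2) inf_le_right
    rw [h3, hd, hN.finrank_inf₂₃ h] at h1
    omega
  obtain ⟨u, hu, hux, huy, huz⟩ := h.exists_ne hα hβ hαβ hd hN
  have hbig : ∀ μ ∈ S, ∀ ν ∈ S, ¬ α ⊓ β ≤ μ → ¬ α ⊓ β ≤ ν → μ ⊓ α ≠ ν ⊓ α →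
      μ ⊓ ν ≤ (α ⊓ β) ⊔ (ρ ⊓ σ) → d + 1 ≤ finrank F ↥(μ ⊓ ((α ⊓ β) ⊔ (ρ ⊓ σ))) := by
    intro μ hμ ν hν hμL hνL hμν hle
    have h1 := nonJunta₃_of_inf_ne hα hμ hν (hne hμL) (hne hνL) (hin μ hμ hμL).1
      (hin ν hν hνL).1 hμν
    rw [← h.finrank_star h1]
    exact Submodule.finrank_mono (le_inf (sup_le inf_le_left inf_le_left)
      (sup_le ((hin μ hμ hμL).2.trans le_sup_left) hle))
  refine h.isClassIV hV' (fun μ hμ => ?_) hN hu hux huy huz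
  by_cases hμL : α ⊓ β ≤ μ
  · rw [← hd]
    exact Submodule.finrank_mono (le_inf hμL le_sup_left)
  -- The traces of ρ and σ on α differ, so μ differs there from at least one of them, and `key` for
  -- that one's partner bounds the intersection.
  by_cases hμρ : μ ⊓ α = ρ ⊓ α
  · refine hbig μ hμ σ hσ hμL hσL (hμρ ▸ hρσ') ?_
    have := key σ hσ ρ hρ μ hμ hσL hρL hρσ'.symm fun e => hρσ' (e ▸ hμρ.symm)
    rwa [inf_comm σ, inf_comm σ] at this
  · refine hbig μ hμ ρ hρ hμL hρL hμρ ?_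
    have := key ρ hρ σ hσ μ hμ hρL hσL hρσ' fun e => hμρ (e ▸ rfl)
    rwa [inf_comm ρ μ] at this

end Star

end IsTight

end

/-! ### One exceptional member: the star configuration and Class I. -/

section

variable [FiniteDimensional F V] {d t : ℕ} {S : Finset (Submodule F V)}

omit [FiniteDimensional F V] in
theorem exists_span_singleton_eq {A : Submodule F V} (h : finrank F A = 1) :
    ∃ v : V, Submodule.span F {v} = A := by
  obtain ⟨v, -, hv⟩ := finrank_eq_one_iff'.mp h
  refine ⟨v, le_antisymm (by simp) fun w hw => ?_⟩
  obtain ⟨c, hc⟩ := hv ⟨w, hw⟩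
  exact Submodule.mem_span_singleton.mpr ⟨c, congrArg Subtype.val hc⟩

/-- A family of `1`-spaces contains a basis of its span. -/
theorem exists_independent_points {ι : Type*} {P : ι → Submodule F V}
    (hP : ∀ i, finrank F (P i) = 1) {m : ℕ} (hm : finrank F ↥(⨆ i, P i) = m) :
    ∃ g : Fin m → ι, Function.Injective g ∧ iSupIndep (P ∘ g) ∧
      ⨆ i, P (g i) = ⨆ i, P i := by
  choose v hv using fun i => exists_span_singleton_eq (hP i)
  obtain ⟨κ, a, ha, hspan, hli⟩ := exists_linearIndependent' F v
  have hP' : ⨆ i, P i = Submodule.span F (Set.range v) := by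
    rw [Submodule.span_range_eq_iSup]
    exact iSup_congr fun i => (hv i).symm
  have hPa : ⨆ k, P (a k) = ⨆ i, P i := by
    rw [hP', ← hspan, Submodule.span_range_eq_iSup]
    exact iSup_congr fun k => (hv (a k)).symm
  have : Finite κ := hli.finite
  have := Fintype.ofFinite κ
  have hcard : Fintype.card κ = m := by
    rw [← hm, hP', ← hspan, finrank_span_eq_card hli]
  let e := Fintype.equivFinOfCardEq hcard
  have hind : iSupIndep (P ∘ a) := by
    have := hli.iSupIndep_span_singleton
    exact (funext fun k => hv (a k) : (fun k => Submodule.span F {(v ∘ a) k}) = P ∘ a) ▸ this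
  refine ⟨a ∘ e.symm, ha.comp e.symm.injective, hind.comp e.symm.injective, ?_⟩
  rw [← hPa]
  exact e.symm.iSup_comp (g := fun k => P (a k))

namespace IsTight

/-- The configuration of a tight set all of whose members but `σ` contain the `d`-space `H`. -/
structure IsStar (d t : ℕ) (S : Finset (Submodule F V)) (σ H Y Q y z : Submodule F V)
    (M : Submodule F V → Submodule F V) : Prop where
  mem : σ ∈ S
  rank : finrank F H = d
  le : ∀ π ∈ S, π ≠ σ → H ≤ π
  nonJunta : NonJunta₃ d S y z σ
  le_Y : Y ≤ H
  rank_Y : finrank F Y + 1 = d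
  disjoint_Y : Disjoint Y Q
  sup_Y : Y ⊔ Q = σ
  rank_Q : finrank F Q = t + 1
  disjoint : Disjoint H Q
  inter : ∀ π ∈ S, π ≠ σ → finrank F ↥(π ⊓ σ) = d
  point : ∀ π ∈ S, π ≠ σ → finrank F ↥(π ⊓ Q) = 1
  sup_M : ∀ π ∈ S, π ≠ σ → H ⊔ (π ⊓ Q) ⊔ M π = π
  disjoint_M : ∀ π ∈ S, π ≠ σ → Disjoint (H ⊔ (π ⊓ Q)) (M π)
  rank_M : ∀ π ∈ S, π ≠ σ → finrank F (M π) = t - 1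

theorem exists_isStar (h : IsTight d t S) {σ H : Submodule F V} (hσ : σ ∈ S)
    (hH : finrank F H = d) (hle : ∀ π ∈ S, π ≠ σ → H ≤ π) :
    ∃ Y Q y z M, IsStar d t S σ H Y Q y z M := by
  have ht := h.two_le
  -- Three members other than σ all contain H, so every triple without a common d-space involves σ.
  have hN : ∃ y z, NonJunta₃ d S y z σ := by
    obtain ⟨x, y, z, hN⟩ := h.exists_nonJunta₃
    by_cases hx : x = σ
    · exact ⟨y, z, hx ▸ hN.rotate⟩
    by_cases hy : y = σ
    · exact ⟨z, x, hy ▸ hN.rotate.rotate⟩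
    by_cases hz : z = σ
    · exact ⟨x, y, hz ▸ hN⟩
    have := Submodule.finrank_mono
      (le_inf (le_inf (hle x hN.mem₁ hx) (hle y hN.mem₂ hy)) (hle z hN.mem₃ hz))
    have := hN.lt
    omega
  obtain ⟨y, z, hN⟩ := hN
  have hyz : H = y ⊓ z := eq_of_le_of_le_finrank
    (le_inf (hle y hN.mem₁ hN.ne₁₃) (hle z hN.mem₂ hN.ne₂₃)) hH.ge (hN.finrank_inf₁₂ h).le
  have hY : finrank F ↥(H ⊓ σ) + 1 = d := by
    have := hN.finrank_inf_add_one h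
    rwa [← hyz] at this
  obtain ⟨Q, hYQ, hsup, hrank⟩ := exists_compl_of_le (inf_le_right : H ⊓ σ ≤ σ)
  rw [h.rank σ hσ] at hrank
  have hQσ : Q ≤ σ := hsup ▸ le_sup_right
  have hHQ : Disjoint H Q := by
    rw [disjoint_iff, eq_bot_iff, ← hYQ.eq_bot]
    exact le_inf (le_inf inf_le_left (inf_le_right.trans hQσ)) inf_le_right
  have hinter : ∀ π ∈ S, π ≠ σ → finrank F ↥(π ⊓ σ) = d := by
    intro x hx hxσ
    by_cases hxy : x = y
    · exact hxy ▸ hN.finrank_inf₁₃ h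
    by_cases hxz : x = z
    · exact hxz ▸ hN.finrank_inf₂₃ h
    -- A member meeting σ in dimension d + 1 would contain y ∩ σ and z ∩ σ, and it contains y ∩ z =
    -- H anyway.
    refine (h.inter x hx σ hσ hxσ).resolve_right fun hd => ?_
    refine hN.not_forall_inf_le h hx hxy hxz hxσ ⟨hyz ▸ hle x hx hxσ, ?_, ?_⟩
    · rw [inf_comm]
      exact h.inf_le_of_finrank hx hσ hN.mem₁ hxσ hxy hN.ne₁₃.symm hd
        (inf_comm y σ ▸ hN.finrank_inf₁₃ h)
    · rw [inf_comm]
      exact h.inf_le_of_finrank hx hσ hN.mem₂ hxσ hxz hN.ne₂₃.symm hd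
        (inf_comm z σ ▸ hN.finrank_inf₂₃ h)
  have hpoint : ∀ π ∈ S, π ≠ σ → finrank F ↥(π ⊓ Q) = 1 := by
    intro x hx hxσ
    -- The modular law splits off H ∩ σ, of dimension d - 1, and leaves a single point of Q.
    have h1 : x ⊓ σ = (H ⊓ σ) ⊔ (x ⊓ Q) := by
      rw [inf_comm x Q, ← sup_inf_assoc_of_le Q (inf_le_left.trans (hle x hx hxσ)), hsup, inf_comm]
    have h2 := hinter x hx hxσ
    rw [h1, finrank_sup_of_disjoint (hYQ.mono_right inf_le_right)] at h2
    omega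
  have hM : ∀ π : Submodule F V, ∃ C, π ∈ S → π ≠ σ → H ⊔ (π ⊓ Q) ⊔ C = π ∧
      Disjoint (H ⊔ (π ⊓ Q)) C ∧ finrank F C = t - 1 := by
    intro x
    by_cases hx : x ∈ S ∧ x ≠ σ
    · obtain ⟨C, h1, h2, h3⟩ := exists_compl_of_le (sup_le (hle x hx.1 hx.2) inf_le_left :
        H ⊔ (x ⊓ Q) ≤ x)
      rw [finrank_sup_of_disjoint (hHQ.mono_right inf_le_right), hH, hpoint x hx.1 hx.2,
        h.rank x hx.1] at h3
      exact ⟨C, fun _ _ => ⟨h2, h1, by omega⟩⟩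
    -- An arbitrary value, never used: complements matter only for members other than σ.
    · exact ⟨⊥, fun h1 h2 => absurd ⟨h1, h2⟩ hx⟩
  choose M hM using hM
  exact ⟨H ⊓ σ, Q, y, z, M, hσ, hH, hle, hN, inf_le_left, hY, hYQ, hsup, by omega, hHQ, hinter,
    hpoint, fun π h1 h2 => (hM π h1 h2).1, fun π h1 h2 => (hM π h1 h2).2.1,
    fun π h1 h2 => (hM π h1 h2).2.2⟩

theorem isClassI_or_isClassIV_of_star (h : IsTight d t S) {α β σ H : Submodule F V} (hα : α ∈ S)
    (hβ : β ∈ S) (hαβ : α ≠ β) (hd : finrank F ↥(α ⊓ β) = d + 1) (hσ : σ ∈ S)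
    (hH : finrank F H = d) (hle : ∀ π ∈ S, π ≠ σ → H ≤ π) :
    IsClassI (d + t) t S.card (S : Set (Submodule F V)) ∨
      IsClassIV (d + t) t S.card (S : Set (Submodule F V)) := by
  classical
  obtain ⟨Y, Q, y, z, M, hs⟩ := h.exists_isStar hσ hH hle
  have ht := h.two_le
  let p : {π // π ∈ S ∧ π ≠ σ} → Submodule F V := fun π => π ⊓ Q
  have hp : ∀ i, finrank F (p i) = 1 := fun i => hs.point i i.2.1 i.2.2
  have hpQ : ⨆ i, p i ≤ Q := iSup_le fun i => inf_le_right
  have hHP := finrank_sup_of_disjoint (hs.disjoint.mono_right hpQ)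
  rw [hH] at hHP
  have hmt := Submodule.finrank_mono hpQ
  rw [hs.rank_Q] at hmt
  let y' : {π // π ∈ S ∧ π ≠ σ} := ⟨y, hs.nonJunta.mem₁, hs.nonJunta.ne₁₃⟩
  let z' : {π // π ∈ S ∧ π ≠ σ} := ⟨z, hs.nonJunta.mem₂, hs.nonJunta.ne₂₃⟩
  -- A common point would lie in y ∩ z = H, which is disjoint from Q.
  have hyz : p y' ≠ p z' := fun e => by
    have hyz : H = y ⊓ z := eq_of_le_of_le_finrank
      (le_inf (hle y y'.2.1 y'.2.2) (hle z z'.2.1 z'.2.2)) hH.ge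
      (hs.nonJunta.finrank_inf₁₂ h).le
    have h1 : p y' ≤ H ⊓ Q := by
      rw [hyz]
      exact le_inf (le_inf inf_le_left ((e ▸ inf_le_left : p y' ≤ z))) inf_le_right
    have h2 := hp y'
    rw [hs.disjoint.eq_bot, le_bot_iff] at h1
    rw [h1, finrank_bot] at h2
    omega
  have hm : 2 ≤ finrank F ↥(⨆ i, p i) := by
    have h1 := finrank_lt_sup (fun hle => hyz
      (eq_of_le_of_le_finrank hle (hp z').ge (hp y').le).symm)
    have h2 : finrank F ↥(p y' ⊔ p z') ≤ finrank F ↥(⨆ i, p i) :=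
      Submodule.finrank_mono (sup_le (le_iSup p y') (le_iSup p z'))
    have h3 := hp y'
    omega
  obtain ⟨m, hmP⟩ : ∃ m, finrank F ↥(⨆ i, p i) = m := ⟨_, rfl⟩
  rw [hmP] at hHP hmt hm
  -- If the points span two dimensions, H together with them is the (d+2)-space of Class IV; σ meets
  -- it in (d - 1) + 2 dimensions.
  rcases hm.eq_or_lt with hm | hm
  · right
    obtain ⟨u, hu, hux, huy, huz⟩ := h.exists_ne hα hβ hαβ hd hs.nonJunta
    refine h.isClassIV (V' := H ⊔ ⨆ i, p i) (by omega) (fun π hπ => ?_) hs.nonJunta hu hux huy huz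
    by_cases hπσ : π = σ
    · subst hπσ
      have h1 : Y ⊔ ⨆ i, p i ≤ π ⊓ (H ⊔ ⨆ i, p i) :=
        le_inf (hs.sup_Y ▸ sup_le_sup_left hpQ Y) (sup_le_sup_right hs.le_Y _)
      have h2 := Submodule.finrank_mono h1
      rw [finrank_sup_of_disjoint (hs.disjoint_Y.mono_right hpQ)] at h2
      have := hs.rank_Y
      omega
    · have h1 : H ⊔ p ⟨π, hπ, hπσ⟩ ≤ π ⊓ (H ⊔ ⨆ i, p i) :=
        le_inf (sup_le (hle π hπ hπσ) inf_le_left) (sup_le_sup_left (le_iSup p _) _)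
      have h2 := Submodule.finrank_mono h1
      rw [finrank_sup_of_disjoint (hs.disjoint.mono_right inf_le_right), hH, hp] at h2
      exact h2
  · left
    -- X is what σ has beyond Y and the points. A basis among the points, extended by the
    -- complements, gives the Nᵢ; the remaining points are the bⱼ.
    obtain ⟨X, hPX, hPXQ, hX⟩ := exists_compl_of_le hpQ
    rw [hs.rank_Q, hmP] at hX
    obtain ⟨g, hg, hgind, hgsup⟩ := exists_independent_points hp hmP
    have : Fintype {π // π ∈ S ∧ π ≠ σ} := Fintype.subtype (S.erase σ) (by simp [and_comm])
    let e := Fintype.equivFin {i // i ∉ Set.range g}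
    have hpM : ∀ i, finrank F ↥(p i ⊔ M i) = t := fun i => by
      rw [finrank_sup_of_disjoint ((hs.disjoint_M i i.2.1 i.2.2).mono_left le_sup_right), hp,
        hs.rank_M i i.2.1 i.2.2]
      omega
    have hcard : m + Fintype.card {i // i ∉ Set.range g} + 1 = S.card := by
      have h1 : Fintype.card {π // π ∈ S ∧ π ≠ σ} = (S.erase σ).card :=
        Fintype.card_of_subtype _ (by simp [and_comm])
      have h2 := Finset.card_erase_add_one hσ
      have h3 := Fintype.card_subtype_compl (fun i => i ∈ Set.range g)
      have h4 : Fintype.card {i // i ∈ Set.range g} = m := by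
        have := Set.card_range_of_injective hg
        rw [Fintype.card_fin] at this
        convert this
      have h5 := Fintype.card_subtype_le (fun i => i ∈ Set.range g)
      omega
    have hcases : ∀ i, (∃ k, g k = i) ∨ ∃ j, (e.symm j : {π // π ∈ S ∧ π ≠ σ}) = i := fun i => by
      by_cases hi : i ∈ Set.range g
      · exact .inl hi
      · exact .inr ⟨e ⟨i, hi⟩, by simp⟩
    have hind : iSupIndep (Sum.elim ![H, X] (Sum.elim (fun k => p (g k) ⊔ M (g k))
        fun j => M (e.symm j))) := by
      apply iSupIndep_of_sum_le_finrank
      have hPN : ⨆ i, p i ≤ ⨆ k, p (g k) ⊔ M (g k) :=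
        hgsup.ge.trans (iSup_mono fun k => le_sup_left)
      have h1 : S.sup id ≤ ⨆ i, Sum.elim ![H, X] (Sum.elim (fun k => p (g k) ⊔ M (g k))
          fun j => M (e.symm j)) i := by
        rw [iSup_sumElim_pair, iSup_sum]
        change _ ≤ H ⊔ X ⊔ ((⨆ k, p (g k) ⊔ M (g k)) ⊔ ⨆ j, M (e.symm j))
        have hHt : H ≤ H ⊔ X ⊔ ((⨆ k, p (g k) ⊔ M (g k)) ⊔ ⨆ j, M (e.symm j)) :=
          le_sup_left.trans le_sup_left
        have hPt : ⨆ i, p i ≤ H ⊔ X ⊔ ((⨆ k, p (g k) ⊔ M (g k)) ⊔ ⨆ j, M (e.symm j)) :=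
          hPN.trans (le_sup_left.trans le_sup_right)
        refine Finset.sup_le fun π hπ => ?_
        by_cases hπσ : π = σ
        · have hσle : π ≤ Y ⊔ ((⨆ i, p i) ⊔ X) := by rw [hPXQ, hs.sup_Y, hπσ]
          exact hσle.trans (sup_le (hs.le_Y.trans hHt)
            (sup_le hPt (le_sup_right.trans le_sup_left)))
        · rw [id, ← hs.sup_M π hπ hπσ]
          refine sup_le (sup_le hHt ((le_iSup p ⟨π, hπ, hπσ⟩).trans hPt)) ?_
          rcases hcases ⟨π, hπ, hπσ⟩ with ⟨k, hk⟩ | ⟨j, hj⟩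
          · have := le_iSup (fun k => p (g k) ⊔ M (g k)) k
            rw [hk] at this
            exact le_sup_right.trans (this.trans (le_sup_left.trans le_sup_right))
          · have := le_iSup (fun j => M (e.symm j)) j
            rw [hj] at this
            exact this.trans (le_sup_right.trans le_sup_right)
      have h2 := Submodule.finrank_mono h1
      have h3 : ∑ j, finrank F (M (e.symm j)) =
          Fintype.card {i // i ∉ Set.range g} * (t - 1) := by
        rw [Finset.sum_congr rfl fun j _ =>
          hs.rank_M _ (e.symm j).1.2.1 (e.symm j).1.2.2]
        simp
      have h4 : ∑ k, finrank F ↥(p (g k) ⊔ M (g k)) = m * t := by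
        rw [Finset.sum_congr rfl fun k _ => hpM _]
        simp
      refine le_trans (le_of_eq ?_) h2
      rw [h.span, sum_finrank_sumElim_pair, hH, Fintype.sum_sum_type]
      change _ + (∑ k, finrank F ↥(p (g k) ⊔ M (g k)) + ∑ j, finrank F (M (e.symm j))) = _
      rw [h3, h4, show S.card - 1 = m +
        Fintype.card {i // i ∉ Set.range g} by omega]
      obtain ⟨t, rfl⟩ := Nat.exists_eq_add_of_le' (show 1 ≤ t by omega)
      rw [Nat.add_sub_cancel, mul_add, add_mul]
      omega
    -- The pair meeting in dimension d + 1 supplies the coincidence of points: each of α, β contains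
    -- the other's intersection with σ, hence the same point of Q.
    have hαβp : ∃ a b : {π // π ∈ S ∧ π ≠ σ}, a ≠ b ∧ p a = p b := by
      have hασ : α ≠ σ := by
        rintro rfl
        have := hs.inter β hβ hαβ.symm
        rw [inf_comm] at this
        omega
      have hβσ : β ≠ σ := by
        rintro rfl
        have := hs.inter α hα hαβ
        omega
      refine ⟨⟨α, hα, hασ⟩, ⟨β, hβ, hβσ⟩, by simpa using hαβ, ?_⟩
      have hQσ : Q ≤ σ := hs.sup_Y ▸ le_sup_right
      have h1 := h.inf_le_of_finrank hα hβ hσ hαβ hασ hβσ hd (hs.inter β hβ hβσ)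
      have h2 := h.inf_le_of_finrank hβ hα hσ hαβ.symm hβσ hασ (inf_comm α β ▸ hd)
        (hs.inter α hα hασ)
      exact le_antisymm (le_inf ((inf_le_inf_left α hQσ).trans h2) inf_le_right)
        (le_inf ((inf_le_inf_left β hQσ).trans h1) inf_le_right)
    unfold IsClassI
    simp only [Nat.add_sub_cancel]
    refine ⟨m, Fintype.card {i // i ∉ Set.range g}, H, X, Y,
      fun k => p (g k) ⊔ M (g k), fun k => p (g k), fun j => M (e.symm j),
      fun j => p (e.symm j), hm, hmt, hcard, hind, hH, by omega, fun k => hpM _,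
      fun j => hs.rank_M _ (e.symm j).1.2.1 (e.symm j).1.2.2, fun k => ⟨hp _, le_sup_left⟩,
      fun j => ⟨hp _, hgsup ▸ le_iSup p _⟩, ?_, ?_, hs.le_Y, ?_⟩
    · obtain ⟨a, b, hab, hpab⟩ := hαβp
      rcases hcases a with ⟨k, rfl⟩ | ⟨j, rfl⟩ <;> rcases hcases b with ⟨k', rfl⟩ | ⟨j', rfl⟩
      -- Two basis points cannot coincide, so at least one of the two members is a bⱼ.
      · have h1 := hgind.pairwiseDisjoint (i := k) (j := k') fun e => hab (e ▸ rfl)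
        have h2 : Disjoint (p (g k)) (p (g k')) := h1
        rw [← hpab, disjoint_self] at h2
        have h3 := hp (g k)
        rw [h2, finrank_bot] at h3
        omega
      · exact .inr ⟨j', k, hpab.symm⟩
      · exact .inr ⟨j, k', hpab⟩
      · exact .inl ⟨j, j', fun e => hab (e ▸ rfl), hpab⟩
    · have := hs.rank_Y
      omega
    · have hk : ∀ k, H ⊔ (p (g k) ⊔ M (g k)) = g k := fun k => by
        rw [← sup_assoc]
        exact hs.sup_M _ (g k).2.1 (g k).2.2
      have hj : ∀ j, H ⊔ M (e.symm j) ⊔ p (e.symm j) = e.symm j := fun j => by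
        rw [sup_right_comm]
        exact hs.sup_M _ (e.symm j).1.2.1 (e.symm j).1.2.2
      have hσ' : Y ⊔ (⨆ k, p (g k)) ⊔ X = σ := by
        rw [hgsup, sup_assoc, hPXQ, hs.sup_Y]
      rw [hσ']
      simp only [hk, hj]
      ext π
      simp only [Finset.mem_coe, Set.mem_union, Set.mem_singleton_iff, Set.mem_range]
      constructor
      · intro hπ
        by_cases hπσ : π = σ
        · exact .inr hπσ
        · rcases hcases ⟨π, hπ, hπσ⟩ with ⟨k, hk⟩ | ⟨j, hj⟩
          · exact .inl (.inl ⟨k, by rw [hk]⟩)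
          · exact .inl (.inr ⟨j, by rw [hj]⟩)
      · rintro ((⟨k, rfl⟩ | ⟨j, rfl⟩) | rfl)
        · exact (g k).2.1
        · exact (e.symm j).1.2.1
        · exact hσ

theorem isClassI_or_isClassIV (h : IsTight d t S) {α β : Submodule F V} (hα : α ∈ S)
    (hβ : β ∈ S) (hαβ : α ≠ β) (hd : finrank F ↥(α ⊓ β) = d + 1) :
    IsClassI (d + t) t S.card (S : Set (Submodule F V)) ∨
      IsClassIV (d + t) t S.card (S : Set (Submodule F V)) := by
  by_cases hstar : ∃ σ ∈ S, ∃ H : Submodule F V, finrank F H = d ∧ ∀ π ∈ S, π ≠ σ → H ≤ π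
  · obtain ⟨σ, hσ, H, hH, hle⟩ := hstar
    exact h.isClassI_or_isClassIV_of_star hα hβ hαβ hd hσ hH hle
  · push Not at hstar
    exact .inr (h.isClassIV_of_not_star hα hβ hαβ hd hstar)

end IsTight

end

end SubspaceCode

theorem theorem3p1 {F V : Type*} [Field F] [AddCommGroup V] [Module F V] [FiniteDimensional F V]
    (k t n : ℕ) (hn : 3 ≤ n) (ht : 2 ≤ t) (htk : t ≤ k - 1) (S : Set (Submodule F V)) :
    (SubspaceCode.IsSPID k {k - t, k - t + 1} S → S.ncard = n →
      Module.finrank F ↥(sSup S) = k + (n - 1) * (t - 1) + 1 →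
      SubspaceCode.IsJunta (k - t) S ∨
        SubspaceCode.IsClassI k t n S ∨ SubspaceCode.IsClassII k t n S ∨
        SubspaceCode.IsClassIII k t n S ∨ SubspaceCode.IsClassIV k t n S) ∧
    (SubspaceCode.IsClassI k t n S ∨ SubspaceCode.IsClassII k t n S ∨
        SubspaceCode.IsClassIII k t n S ∨ SubspaceCode.IsClassIV k t n S →
      S.ncard = n ∧
      (∀ π ∈ S, Module.finrank F π = k) ∧
      (∀ π ∈ S, ∀ ρ ∈ S, π ≠ ρ → Module.finrank F ↥(π ⊓ ρ) ∈ ({k - t, k - t + 1} : Set ℕ)) ∧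
      Module.finrank F ↥(sSup S) = k + (n - 1) * (t - 1) + 1 ∧
      ¬ SubspaceCode.IsJunta (k - t) S) := by
  obtain ⟨d, rfl⟩ : ∃ d, k = d + t := ⟨k - t, by omega⟩
  rw [Nat.add_sub_cancel]
  constructor
  · intro hS hcard hspan
    by_cases hJ : SubspaceCode.IsJunta d S
    · exact .inl hJ
    have hfin : S.Finite := Set.finite_of_ncard_ne_zero (by omega)
    lift S to Finset (Submodule F V) using hfin
    rw [Set.ncard_coe_finset] at hcard
    subst hcard
    have h : SubspaceCode.IsTight d t S := by
      refine ⟨ht, hS.finrank_eq, fun π hπ ρ hρ hne => hS.inter_mem π hπ ρ hρ hne,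
        hS.attained d (by simp), ?_, hJ⟩
      rw [Finset.sup_id_eq_sSup]
      exact hspan
    obtain ⟨α, hα, β, hβ, hαβ, hd⟩ := hS.attained (d + 1) (by simp)
    -- Only Classes I and IV occur here; SPIDs in Class II or III are thereby covered too.
    rcases h.isClassI_or_isClassIV hα hβ hαβ hd with h | h
    · exact .inr (.inl h)
    · exact .inr (.inr (.inr (.inr h)))
  · rintro (h | h | h | h)
    · exact h.isExtremal ht (by omega)
    · exact h.isExtremal hn ht
    · exact h.isExtremal ht
    · exact h.isExtremal ht
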